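/- Let $r,m,p$ be nonnegative integers and let $\mathbb{C}^+=\{s\in\mathbb{C}:\operatorname{Re}s>0\}$. Let $\mathcal{H}_2$ be the Hardy space of analytic functions $F:\mathbb{C}^+\to\mathbb{C}^{p\times m}$ with $\sup_{\xi>0}\int_{-\infty}^{\infty}\|F(\xi+\mathrm{i}\omega)\|_{\mathrm F}^2\,\mathrm{d}\omega<\infty$, with the inner product \[ \langle F,G\rangle=\frac{1}{2\pi}\int_{-\infty}^{\infty}\operatorname{tr}\bigl(F(\mathrm{i}\omega)^*G(\mathrm{i}\omega)\bigr)\,\mathrm{d}\omega , \] where $\omega\mapsto F(\mathrm{i}\omega)$ denotes the boundary function of $F$, i.e. the limit of $F(\xi+\mathrm{i}\,\cdot\,)$ in $L^2$ as $\xi\to0^+$, and with the norm $\|F\|=\langle F,F\rangle^{1/2}=\sup_{\xi>0}\bigl(\frac1{2\pi}\int_{-\infty}^{\infty}\|F(\xi+\mathrm{i}\omega)\|_{\mathrm F}^2\,\mathrm{d}\omega\bigr)^{1/2}$. Let $\Sigma=\Sigma^-_{r,m,p}(\mathbb{C})\subset\mathcal{H}_2$ be the set of all functions $s\mapsto C(sI-A)^{-1}B$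 with $A\in\mathbb{C}^{r\times r}$, $B\in\mathbb{C}^{r\times m}$, $C\in\mathbb{C}^{p\times r}$, where all eigenvalues of $A$ have negative real part and $(A,B,C)$ is minimal, i.e. no realization of the same rational function has order smaller than $r$. For $\hat H\in\Sigma$ let \[ T_{\hat H}\Sigma=\{\gamma'(0) : \gamma:(-\varepsilon,\varepsilon)\to\mathcal{H}_2 \text{ smooth for some } \varepsilon>0,\ \gamma(t)\in\Sigma \text{ for all } t,\ \gamma(0)=\hat H\}\subset\mathcal{H}_2 \] be the tangent space of $\Sigma$ at $\hat H$. Let $\hat H\in\Sigma$ have the pole-residue form $\hat H(s)=\sum_{i=1}^{r}\frac{c_i b_i^*}{s-\lambda_i}$ with pairwise distinct $\lambda_i\in\mathbb{C}$, $b_i\in\mathbb{C}^m$, $c_i\in\mathbb{C}^p$, and let $F\in\mathcal{H}_2$. Then $F\perp T_{\hat H}\Sigma$, i.e. $\langle G,F\rangle=0$ for all $G\in T_{\hat H}\Sigma$, if and only if \[ F(-\overline{\lambda_i})\,b_i=0,\qquad c_i^*F(-\overline{\lambda_i})=0,\qquad c_i^*F'(-\overline{\lambda_i})\,b_i=0\qquad\text{for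 } i=1,\dots,r . \] -/

import Mathlib

open scoped ContDiff Topology ENNReal Matrix ComplexConjugate

noncomputable section

/-- A matrix, seen as the Euclidean vector of its entries; the norm of this vector is the Frobenius
norm of the matrix. -/
def frobeniusVec {p m : ℕ} (M : Matrix (Fin p) (Fin m) ℂ) : EuclideanSpace ℂ (Fin p × Fin m) :=
  WithLp.toLp 2 fun ij => M ij.1 ij.2

/-- The (entrywise) complex derivative `F'(s)` of a matrix-valued function. -/
def matrixDeriv {p m : ℕ} (F : ℂ → Matrix (Fin p) (Fin m) ℂ) (s : ℂ) :
    Matrix (Fin p) (Fin m) ℂ :=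
  Matrix.of fun i j => deriv (fun z => F z i j) s

/-- The restriction `y ↦ F(ξ + iy)` of `F` to the vertical line `Re s = ξ`. -/
def verticalSlice {p m : ℕ} (F : ℂ → Matrix (Fin p) (Fin m) ℂ) (ξ : ℝ) :
    ℝ → EuclideanSpace ℂ (Fin p × Fin m) :=
  fun y => frobeniusVec (F (ξ + y * Complex.I))

/-- `sup_{ξ > 0} (∫ ‖F(ξ + iy)‖_F² dy)^{1/2}`, as an extended nonnegative number. -/
def hardyGauge {p m : ℕ} (F : ℂ → Matrix (Fin p) (Fin m) ℂ) : ℝ≥0∞ :=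
  ⨆ ξ : Set.Ioi (0 : ℝ), MeasureTheory.eLpNorm (verticalSlice F ξ) 2 MeasureTheory.volume

/-- `F` is analytic on the open right half-plane. Functions on the half-plane are represented by
functions on `ℂ` that vanish outside it, so that equality of representatives is equality on
the half-plane. -/
structure IsHalfPlaneAnalytic {p m : ℕ} (F : ℂ → Matrix (Fin p) (Fin m) ℂ) : Prop where
  differentiableOn : ∀ i j, DifferentiableOn ℂ (fun s => F s i j) {s | 0 < s.re}
  eq_zero : ∀ s : ℂ, s.re ≤ 0 → F s = 0

theorem IsHalfPlaneAnalytic.continuous_slice {p m : ℕ} {F : ℂ → Matrix (Fin p) (Fin m) ℂ}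
    (hF : IsHalfPlaneAnalytic F) {ξ : ℝ} (hξ : 0 < ξ) : Continuous (verticalSlice F ξ) := by
  refine (PiLp.continuous_toLp 2 _).comp (continuous_pi fun ij => ?_)
  refine (hF.differentiableOn ij.1 ij.2).continuousOn.comp_continuous
    (f := fun y : ℝ => (ξ : ℂ) + y * Complex.I) (by fun_prop) fun y => ?_
  simpa using hξ

theorem hardyGauge_add_le {p m : ℕ} {F G : ℂ → Matrix (Fin p) (Fin m) ℂ}
    (hF : IsHalfPlaneAnalytic F) (hG : IsHalfPlaneAnalytic G) :
    hardyGauge (F + G) ≤ hardyGauge F + hardyGauge G := by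
  refine iSup_le fun ξ => ?_
  refine (MeasureTheory.eLpNorm_add_le (f := verticalSlice F ξ) (g := verticalSlice G ξ)
    (hF.continuous_slice ξ.2).aestronglyMeasurable
    (hG.continuous_slice ξ.2).aestronglyMeasurable (by norm_num)).trans ?_
  exact add_le_add
    (le_iSup (fun ξ : Set.Ioi (0 : ℝ) => MeasureTheory.eLpNorm (verticalSlice F ξ) 2 MeasureTheory.volume) ξ)
    (le_iSup (fun ξ : Set.Ioi (0 : ℝ) => MeasureTheory.eLpNorm (verticalSlice G ξ) 2 MeasureTheory.volume) ξ)

theorem hardyGauge_smul {p m : ℕ} (a : ℂ) (F : ℂ → Matrix (Fin p) (Fin m) ℂ) :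
    hardyGauge (a • F) = ‖a‖ₑ * hardyGauge F := by
  unfold hardyGauge
  rw [ENNReal.mul_iSup]
  exact iSup_congr fun ξ => MeasureTheory.eLpNorm_const_smul a (verticalSlice F ξ) 2 _

theorem hardyGauge_zero {p m : ℕ} : hardyGauge (0 : ℂ → Matrix (Fin p) (Fin m) ℂ) = 0 := by
  simpa using hardyGauge_smul 0 (0 : ℂ → Matrix (Fin p) (Fin m) ℂ)

theorem eq_zero_of_hardyGauge_eq_zero {p m : ℕ} {F : ℂ → Matrix (Fin p) (Fin m) ℂ}
    (hF : IsHalfPlaneAnalytic F) (h : hardyGauge F = 0) : F = 0 := by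
  funext s
  rcases le_or_gt s.re 0 with hs | hs
  · exact hF.eq_zero s hs
  · have h1 : MeasureTheory.eLpNorm (verticalSlice F s.re) 2 MeasureTheory.volume = 0 :=
      le_antisymm (h ▸ le_iSup (fun ξ : Set.Ioi (0 : ℝ) =>
        MeasureTheory.eLpNorm (verticalSlice F ξ) 2 MeasureTheory.volume) ⟨s.re, hs⟩) bot_le
    have hc := hF.continuous_slice hs
    rw [MeasureTheory.eLpNorm_eq_zero_iff hc.aestronglyMeasurable (by norm_num)] at h1
    have h2 := congrFun ((hc.ae_eq_iff_eq MeasureTheory.volume continuous_const).1 h1) s.im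
    ext i j
    have h3 := congrArg (fun v : EuclideanSpace ℂ (Fin p × Fin m) => v (i, j)) h2
    simpa [verticalSlice, frobeniusVec, Complex.re_add_im] using h3

/-- The space of analytic functions on the open right half-plane with
`sup_{ξ > 0} ∫ ‖F(ξ + iy)‖_F² dy < ∞`, as a subspace of a function space. -/
def hardySubmodule (p m : ℕ) : Submodule ℂ (ℂ → Matrix (Fin p) (Fin m) ℂ) where
  carrier := {F | IsHalfPlaneAnalytic F ∧ hardyGauge F < ⊤}
  zero_mem' := ⟨⟨fun _ _ => differentiableOn_const 0, fun _ _ => rfl⟩, by simp [hardyGauge_zero]⟩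
  add_mem' := fun {F G} hF hG =>
    ⟨⟨fun i j => (hF.1.differentiableOn i j).add (hG.1.differentiableOn i j), fun s hs => by
      simp [hF.1.eq_zero s hs, hG.1.eq_zero s hs]⟩,
      (hardyGauge_add_le hF.1 hG.1).trans_lt (ENNReal.add_lt_top.2 ⟨hF.2, hG.2⟩)⟩
  smul_mem' := fun a F hF =>
    ⟨⟨fun i j => (hF.1.differentiableOn i j).const_smul a, fun s hs => by simp [hF.1.eq_zero s hs]⟩, by
      show hardyGauge (a • F) < ⊤
      rw [hardyGauge_smul]
      exact ENNReal.mul_lt_top (by simp) hF.2⟩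

/-- The Hardy space `H₂^{p × m}` of the open right half-plane. -/
def HardyTwo (p m : ℕ) : Type := hardySubmodule p m

namespace HardyTwo

variable {p m : ℕ}

instance : AddCommGroup (HardyTwo p m) := inferInstanceAs (AddCommGroup (hardySubmodule p m))

instance : Module ℂ (HardyTwo p m) := inferInstanceAs (Module ℂ (hardySubmodule p m))

instance : CoeFun (HardyTwo p m) (fun _ => ℂ → Matrix (Fin p) (Fin m) ℂ) := ⟨fun F => F.1⟩

/-- The `H₂` norm `sup_{ξ > 0} ((1/2π) ∫ ‖F(ξ + iy)‖_F² dy)^{1/2}`. -/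
instance : Norm (HardyTwo p m) := ⟨fun F => (√(2 * Real.pi))⁻¹ * (hardyGauge F.1).toReal⟩

theorem norm_def (F : HardyTwo p m) :
    ‖F‖ = (√(2 * Real.pi))⁻¹ * (hardyGauge F.1).toReal := rfl

theorem normCore : NormedSpace.Core ℂ (HardyTwo p m) where
  norm_nonneg F := by rw [norm_def]; positivity
  norm_smul a F := by
    have : hardyGauge (a • F).1 = ‖a‖ₑ * hardyGauge F.1 := hardyGauge_smul a F.1
    rw [norm_def, norm_def, this, ENNReal.toReal_mul, toReal_enorm]
    ring
  norm_triangle F G := by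
    rw [norm_def, norm_def, norm_def, ← mul_add]
    refine mul_le_mul_of_nonneg_left ?_ (by positivity)
    rw [← ENNReal.toReal_add F.2.2.ne G.2.2.ne]
    exact ENNReal.toReal_mono (ENNReal.add_lt_top.2 ⟨F.2.2, G.2.2⟩).ne
      (hardyGauge_add_le F.2.1 G.2.1)
  norm_eq_zero_iff F := by
    constructor
    · intro h
      rw [norm_def, mul_eq_zero, or_iff_right (by positivity),
        ENNReal.toReal_eq_zero_iff, or_iff_left F.2.2.ne] at h
      exact Subtype.ext (eq_zero_of_hardyGauge_eq_zero F.2.1 h)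
    · rintro rfl
      have : hardyGauge (0 : HardyTwo p m).1 = 0 := hardyGauge_zero
      rw [norm_def, this]
      simp

instance : NormedAddCommGroup (HardyTwo p m) := NormedAddCommGroup.ofCore normCore

instance : NormedSpace ℂ (HardyTwo p m) := NormedSpace.ofCore normCore

/-- `f` is a boundary function `y ↦ F(iy)` of `F` on the imaginary axis: the restrictions of `F`
to the lines `Re s = ξ` converge to `f` in `L²` as `ξ → 0⁺`. -/
def IsBoundaryFunction (F : HardyTwo p m) (f : ℝ → Matrix (Fin p) (Fin m) ℂ) : Prop :=
  MeasureTheory.MemLp (fun y => frobeniusVec (f y)) 2 MeasureTheory.volume ∧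
    Filter.Tendsto (fun ξ : ℝ => MeasureTheory.eLpNorm (verticalSlice F ξ - fun y => frobeniusVec (f y)) 2 MeasureTheory.volume)
      (𝓝[>] 0) (𝓝 0)

open Classical in
/-- The extension `y ↦ F(iy)` of `F` to the imaginary axis (unique up to null sets). -/
def boundary (F : HardyTwo p m) : ℝ → Matrix (Fin p) (Fin m) ℂ :=
  if h : ∃ f, IsBoundaryFunction F f then h.choose else 0

/-- The inner product `⟨F, G⟩ = (1/2π) ∫ tr(F(iy)^* G(iy)) dy`. -/
def innerH2 (F G : HardyTwo p m) : ℂ :=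
  (1 / (2 * Real.pi) : ℂ) * ∫ y : ℝ, ((F.boundary y)ᴴ * G.boundary y).trace

/-- `F` is orthogonal to every element of `T`. -/
def IsOrthogonalTo (F : HardyTwo p m) (T : Set (HardyTwo p m)) : Prop :=
  ∀ G ∈ T, innerH2 G F = 0

end HardyTwo

/-- The transfer function `s ↦ C (sI - A)⁻¹ B`. -/
def transferFunction {r p m : ℕ} (A : Matrix (Fin r) (Fin r) ℂ) (B : Matrix (Fin r) (Fin m) ℂ)
    (C : Matrix (Fin p) (Fin r) ℂ) (s : ℂ) : Matrix (Fin p) (Fin m) ℂ :=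
  C * (s • (1 : Matrix (Fin r) (Fin r) ℂ) - A)⁻¹ * B

/-- All eigenvalues lie in the open left half-plane. -/
def IsHurwitz {r : ℕ} (A : Matrix (Fin r) (Fin r) ℂ) : Prop :=
  ∀ z ∈ spectrum ℂ A, z.re < 0

/-- `(A, B, C)` has the least order among all realizations of its transfer function. Two
realizations have the same rational transfer function iff the transfer functions agree at all
points that are an eigenvalue of neither state matrix. -/
def IsMinimalRealization {r p m : ℕ} (A : Matrix (Fin r) (Fin r) ℂ)
    (B : Matrix (Fin r) (Fin m) ℂ) (C : Matrix (Fin p) (Fin r) ℂ) : Prop :=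
  ∀ (k : ℕ) (A' : Matrix (Fin k) (Fin k) ℂ) (B' : Matrix (Fin k) (Fin m) ℂ)
    (C' : Matrix (Fin p) (Fin k) ℂ),
    (∀ s : ℂ, s ∉ spectrum ℂ A → s ∉ spectrum ℂ A' →
      transferFunction A' B' C' s = transferFunction A B C s) → r ≤ k

/-- The set of stable rational functions of McMillan degree `r`, as a subset of `H₂`. -/
def stableRational (r m p : ℕ) : Set (HardyTwo p m) :=
  {H | ∃ (A : Matrix (Fin r) (Fin r) ℂ) (B : Matrix (Fin r) (Fin m) ℂ)
      (C : Matrix (Fin p) (Fin r) ℂ), IsHurwitz A ∧ IsMinimalRealization A B C ∧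
      ∀ s : ℂ, 0 < s.re → H s = transferFunction A B C s}

/-- The tangent space of a submanifold `M` of a normed space `E` at a point `x`, as a subset of
`E`: the velocities `c'(0)` of smooth curves `c` in `M`, defined on an interval around `0`,
with `c(0) = x`. -/
def tangentSpaceAt {E : Type*} [NormedAddCommGroup E] [NormedSpace ℝ E] (M : Set E) (x : E) :
    Set E :=
  {v | ∃ (ε : ℝ) (c : ℝ → E), 0 < ε ∧ ContDiffOn ℝ ∞ c (Set.Ioo (-ε) ε) ∧
      (∀ t ∈ Set.Ioo (-ε) ε, c t ∈ M) ∧ c 0 = x ∧ HasDerivAt c v 0}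

end

/-! The tangent space at `Hhat` is spanned by the functions `x bᵢ* / (s - λᵢ)`, `cᵢ y* / (s - λᵢ)`
and `cᵢ bᵢ* / (s - λᵢ)²`, the velocities obtained by moving `cᵢ`, `bᵢ` and `λᵢ`. The inner product
of `F` with a simple pole at `λᵢ` evaluates `F` at `-conj λᵢ`, and with a double pole it evaluates
`-F'` there. Testing against the three families gives the three interpolation conditions.

Analytic side. The inner product of two slices depends only on the sum of their abscissas, because
the integral of an analytic function along a vertical line does not depend on the line
(`integral_verticalLine_eq`). Together with boundedness this forces the slices to converge in `L²`
(`exists_tendsto_of_inner_eq_of_add_eq`), so boundary functions exist and the inner product is a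
limit of inner products on interior lines. On those lines, Cauchy's formula
`integral_div_verticalLine_eq` gives the reproducing property of simple poles, and differentiation
in the pole gives that of double poles.

Algebraic side. The delicate point is that there are no other tangent vectors: a curve in `Σ` does
not come with a differentiable family of realizations. Near `Hhat` the whole function is recovered
from a Loewner pencil built from finitely many point values (`transferFunction_eq_loewner`). Point
values are continuous linear functionals, so this formula can be differentiated along any
differentiable curve (`exists_form_of_hasDerivAt`), and partial fractions put the result into the
span. The same Loewner matrices show that the given pole-residue form has nonzero residues and
stable poles, and that small perturbations of it stay in `Σ`. -/

open MeasureTheory Filter Set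

/-! ### Integrals along vertical lines and convergence of slices -/

theorem continuous_verticalLine (x : ℝ) : Continuous fun y : ℝ => (x : ℂ) + y * Complex.I := by
  fun_prop

theorem integrable_verticalLine {q : ℂ → ℂ} {a b x : ℝ} (hx : x ∈ Icc a b)
    (hq : ContinuousOn q {s | s.re ∈ Icc a b})
    (hbd : ∫⁻ y : ℝ, ‖q (x + y * Complex.I)‖ₑ < ⊤) :
    Integrable fun y : ℝ => q (x + y * Complex.I) :=
  ⟨(hq.comp_continuous (continuous_verticalLine x) fun y => by simpa using hx).aestronglyMeasurable,
    hbd⟩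

/-- The integral of an analytic function along a vertical line does not depend on the line, within
a strip where the `L¹` norms on vertical lines are bounded. -/
theorem integral_verticalLine_eq {q : ℂ → ℂ} {a b : ℝ} (hab : a ≤ b)
    (hq : DifferentiableOn ℂ q {s | s.re ∈ Icc a b}) {K : ℝ≥0∞} (hK : K ≠ ⊤)
    (hbd : ∀ x ∈ Icc a b, ∫⁻ y : ℝ, ‖q (x + y * Complex.I)‖ₑ ≤ K) :
    ∫ y : ℝ, q (a + y * Complex.I) = ∫ y : ℝ, q (b + y * Complex.I) := by
  have hline : ∀ x ∈ Icc a b, Integrable fun y : ℝ => q (x + y * Complex.I) := fun x hx =>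
    integrable_verticalLine hx hq.continuousOn ((hbd x hx).trans_lt hK.lt_top)
  set h : ℝ → ℂ := fun T => ∫ x in a..b, q (x + T * Complex.I) with hh
  have hprod : Integrable (fun z : ℝ × ℝ => q (z.1 + z.2 * Complex.I))
      ((volume.restrict (Ioc a b)).prod volume) := by
    have hcont : ContinuousOn (fun z : ℝ × ℝ => q (z.1 + z.2 * Complex.I))
        (Ioc a b ×ˢ univ) := by
      refine hq.continuousOn.comp (by fun_prop) fun z hz => ?_
      simpa using Ioc_subset_Icc_self hz.1
    have hmeas : AEStronglyMeasurable (fun z : ℝ × ℝ => q (z.1 + z.2 * Complex.I))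
        ((volume.restrict (Ioc a b)).prod volume) := by
      have := hcont.aestronglyMeasurable (μ := (volume : Measure ℝ).prod (volume : Measure ℝ))
        (measurableSet_Ioc.prod MeasurableSet.univ)
      rwa [← Measure.prod_restrict, Measure.restrict_univ] at this
    refine ⟨hmeas, ?_⟩
    rw [HasFiniteIntegral, lintegral_prod _ hmeas.enorm]
    calc _ ≤ ∫⁻ x in Ioc a b, K := by
          refine setLIntegral_mono measurable_const fun x hx => hbd x (Ioc_subset_Icc_self hx)
      _ < ⊤ := by
          rw [setLIntegral_const]
          exact ENNReal.mul_lt_top hK.lt_top (by simp)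
  -- By Fubini, the integral `h T` over the horizontal edge is integrable in the height `T`, so `h T
  -- - h (-T)` can tend only to zero. Cauchy's theorem on the rectangle identifies its limit with
  -- `I` times the difference of the two line integrals.
  have hint : Integrable h := by
    have := hprod.integral_prod_right
    simpa only [hh, intervalIntegral.integral_of_le hab] using this
  have hrect : ∀ T : ℝ, h T - h (-T) =
      Complex.I * ((∫ y in (-T)..T, q (b + y * Complex.I)) -
        ∫ y in (-T)..T, q (a + y * Complex.I)) := by
    intro T
    have := Complex.integral_boundary_rect_eq_zero_of_differentiableOn q
      (a + (-T : ℝ) * Complex.I) (b + T * Complex.I) (hq.mono fun s hs => by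
        have := hs.1
        simpa [uIcc_of_le hab] using this)
    simp only [Complex.add_re, Complex.ofReal_re, Complex.mul_re, Complex.I_re, mul_zero,
      Complex.ofReal_im, Complex.I_im, mul_one, sub_self, add_zero, Complex.add_im,
      Complex.mul_im, zero_add, smul_eq_mul] at this
    simp only [hh]
    linear_combination -this
  have hlim : Tendsto (fun T => h T - h (-T)) atTop
      (𝓝 (Complex.I * ((∫ y : ℝ, q (b + y * Complex.I)) - ∫ y : ℝ, q (a + y * Complex.I)))) := by
    simp only [hrect]
    refine Tendsto.const_mul _ (Tendsto.sub ?_ ?_)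
    · exact intervalIntegral_tendsto_integral (hline b ⟨hab, le_rfl⟩) tendsto_neg_atTop_atBot
        tendsto_id
    · exact intervalIntegral_tendsto_integral (hline a ⟨le_rfl, hab⟩) tendsto_neg_atTop_atBot
        tendsto_id
  have hzero := IntegrableAtFilter.eq_zero_of_tendsto
    ((hint.sub hint.comp_neg).integrableAtFilter atTop) (fun s hs => by
      obtain ⟨T, hT⟩ := mem_atTop_sets.1 hs
      exact eq_top_iff.2 ((by simp : (⊤ : ℝ≥0∞) ≤ volume (Ici T)).trans (measure_mono hT))) hlim
  rcases mul_eq_zero.1 hzero with h0 | h0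
  · exact absurd h0 Complex.I_ne_zero
  · exact (sub_eq_zero.1 h0).symm

/-- A bounded family `u ξ`, `ξ > 0`, in a Hilbert space whose inner products `⟪u ξ, u η⟫` depend
only on `ξ + η` converges as `ξ → 0⁺`. -/
theorem exists_tendsto_of_inner_eq_of_add_eq {H : Type*} [NormedAddCommGroup H]
    [InnerProductSpace ℂ H] [CompleteSpace H] (u : ℝ → H) {M : ℝ}
    (hM : ∀ ξ, 0 < ξ → ‖u ξ‖ ≤ M)
    (hu : ∀ ξ η ξ' η' : ℝ, 0 < ξ → 0 < η → 0 < ξ' → 0 < η' → ξ + η = ξ' + η' →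
      inner ℂ (u ξ) (u η) = inner ℂ (u ξ') (u η')) :
    ∃ l, Tendsto u (𝓝[>] 0) (𝓝 l) := by
  set N : ℝ → ℝ := fun ξ => ‖u ξ‖ ^ 2 with hN
  -- The cross term is itself a squared norm, that of the midpoint slice. So `N` is midpoint convex,
  -- and its convexity defect measures the distance of `u ξ` and `u η`.
  have hsub : ∀ ξ η, 0 < ξ → 0 < η → ‖u ξ - u η‖ ^ 2 = N ξ + N η - 2 * N ((ξ + η) / 2) := by
    intro ξ η hξ hη
    have hmid : inner ℂ (u ξ) (u η) = inner ℂ (u ((ξ + η) / 2)) (u ((ξ + η) / 2)) :=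
      hu _ _ _ _ hξ hη (by linarith) (by linarith) (by ring)
    rw [@norm_sub_sq ℂ, hmid, inner_self_eq_norm_sq_to_K]
    simp only [hN]
    norm_cast
    ring
  have hNM : ∀ ξ, 0 < ξ → N ξ ≤ M ^ 2 := fun ξ hξ =>
    pow_le_pow_left₀ (norm_nonneg _) (hM ξ hξ) 2
  -- A bounded midpoint convex function on a half-line cannot increase: along the progression `a + k
  -- (b - a)` the increments are nondecreasing, so one positive increment would force linear growth
  -- past `M ^ 2`.
  have hanti : ∀ a b, 0 < a → a ≤ b → N b ≤ N a := by
    intro a b ha hab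
    by_contra! hlt
    have hd : 0 ≤ b - a := sub_nonneg.2 hab
    have hpos : ∀ k : ℕ, 0 < a + k * (b - a) := fun k => by positivity
    have hinc : ∀ k : ℕ, N b - N a ≤ N (a + (k + 1 : ℕ) * (b - a)) - N (a + k * (b - a)) := by
      intro k
      induction k with
      | zero => simp
      | succ k ih =>
        have h := hsub _ _ (hpos k) (hpos (k + 2))
        have hmid : (a + k * (b - a) + (a + (k + 2 : ℕ) * (b - a))) / 2 =
            a + (k + 1 : ℕ) * (b - a) := by push_cast; ring
        rw [hmid] at h
        have h0 : 0 ≤ ‖u (a + k * (b - a)) - u (a + (k + 2 : ℕ) * (b - a))‖ ^ 2 := by positivity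
        linarith
    have hgrow : ∀ k : ℕ, N a + k * (N b - N a) ≤ N (a + k * (b - a)) := by
      intro k
      induction k with
      | zero => simp
      | succ k ih =>
        have := hinc k
        push_cast at *
        linarith
    obtain ⟨k, hk⟩ := exists_nat_gt ((M ^ 2 - N a) / (N b - N a))
    rw [div_lt_iff₀ (sub_pos.2 hlt)] at hk
    have h1 := hgrow k
    have h2 := hNM _ (hpos k)
    linarith
  have hbdd : BddAbove (N '' Ioi 0) := ⟨M ^ 2, by rintro _ ⟨ξ, hξ, rfl⟩; exact hNM ξ hξ⟩
  have hne : (N '' Ioi 0).Nonempty := ⟨_, 1, by simp, rfl⟩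
  have hcauchy : Cauchy (map u (𝓝[>] (0 : ℝ))) := by
    rw [Metric.cauchy_iff]
    refine ⟨inferInstance, fun ε hε => ?_⟩
    -- Since `N` is nonincreasing, all its values on `(0, ξ₀)` lie within `ε ^ 2 / 2` of the
    -- supremum, and the convexity defect there is less than `ε ^ 2`.
    obtain ⟨_, ⟨ξ₀, hξ₀, rfl⟩, hlt⟩ := exists_lt_of_lt_csSup hne
      (sub_lt_self (sSup (N '' Ioi 0)) (by positivity : 0 < ε ^ 2 / 2))
    refine ⟨u '' Ioo 0 ξ₀, image_mem_map (Ioo_mem_nhdsGT hξ₀), ?_⟩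
    rintro _ ⟨ξ, hξ, rfl⟩ _ ⟨η, hη, rfl⟩
    rw [dist_eq_norm]
    refine lt_of_pow_lt_pow_left₀ 2 hε.le ?_
    rw [hsub ξ η hξ.1 hη.1]
    have h1 := le_csSup hbdd ⟨ξ, hξ.1, rfl⟩
    have h2 := le_csSup hbdd ⟨η, hη.1, rfl⟩
    have h3 := hanti ((ξ + η) / 2) ξ₀ (by linarith [hξ.1, hη.1]) (by linarith [hξ.2, hη.2])
    linarith
  exact CompleteSpace.complete hcauchy

/-! ### Boundary functions and the inner product -/

namespace HardyTwo

variable {p m : ℕ}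

/-- Equality in the Hardy space is equality on the half-plane. -/
theorem ext_of_re_pos {F G : HardyTwo p m} (h : ∀ s : ℂ, 0 < s.re → F s = G s) : F = G := by
  refine Subtype.ext (funext fun s => ?_)
  rcases le_or_gt s.re 0 with hs | hs
  · rw [F.2.1.eq_zero s hs, G.2.1.eq_zero s hs]
  · exact h s hs

theorem eLpNorm_slice_le (F : HardyTwo p m) {ξ : ℝ} (hξ : 0 < ξ) :
    eLpNorm (verticalSlice F ξ) 2 volume ≤ hardyGauge F :=
  le_iSup (fun ξ : Ioi (0 : ℝ) => eLpNorm (verticalSlice F ξ) 2 volume) ⟨ξ, hξ⟩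

theorem memLp_slice (F : HardyTwo p m) {ξ : ℝ} (hξ : 0 < ξ) :
    MemLp (verticalSlice F ξ) 2 volume :=
  ⟨(F.2.1.continuous_slice hξ).aestronglyMeasurable, (F.eLpNorm_slice_le hξ).trans_lt F.2.2⟩

open Classical in
/-- The restriction of `F` to the line `Re s = ξ`, as an element of `L²`. -/
noncomputable def sliceLp (F : HardyTwo p m) (ξ : ℝ) :
    Lp (EuclideanSpace ℂ (Fin p × Fin m)) 2 (volume : Measure ℝ) :=
  if hξ : 0 < ξ then (F.memLp_slice hξ).toLp _ else 0

theorem sliceLp_of_pos (F : HardyTwo p m) {ξ : ℝ} (hξ : 0 < ξ) :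
    F.sliceLp ξ = (F.memLp_slice hξ).toLp _ := dif_pos hξ

theorem sliceLp_add (F G : HardyTwo p m) (ξ : ℝ) :
    (F + G).sliceLp ξ = F.sliceLp ξ + G.sliceLp ξ := by
  unfold sliceLp
  split_ifs with hξ
  · exact MemLp.toLp_add (F.memLp_slice hξ) (G.memLp_slice hξ)
  · simp

theorem sliceLp_smul (a : ℂ) (F : HardyTwo p m) (ξ : ℝ) :
    (a • F).sliceLp ξ = a • F.sliceLp ξ := by
  unfold sliceLp
  split_ifs with hξ
  · exact MemLp.toLp_const_smul a (F.memLp_slice hξ)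
  · simp

theorem sqrt_two_pi_mul_norm (F : HardyTwo p m) :
    √(2 * Real.pi) * ‖F‖ = (hardyGauge F).toReal := by
  rw [norm_def, ← mul_assoc, mul_inv_cancel₀ (by positivity), one_mul]

theorem norm_sliceLp_le (F : HardyTwo p m) (ξ : ℝ) :
    ‖F.sliceLp ξ‖ ≤ √(2 * Real.pi) * ‖F‖ := by
  unfold sliceLp
  split_ifs with hξ
  · rw [Lp.norm_toLp, sqrt_two_pi_mul_norm]
    exact ENNReal.toReal_mono F.2.2.ne (F.eLpNorm_slice_le hξ)
  · rw [norm_zero]; positivity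

theorem inner_frobeniusVec (M N : Matrix (Fin p) (Fin m) ℂ) :
    inner ℂ (frobeniusVec M) (frobeniusVec N) = (Mᴴ * N).trace := by
  simp only [PiLp.inner_apply, frobeniusVec, Matrix.trace, Matrix.diag, Matrix.mul_apply,
    Matrix.conjTranspose_apply, RCLike.inner_apply, Fintype.sum_prod_type_right]
  refine Finset.sum_congr rfl fun j _ => Finset.sum_congr rfl fun i _ => ?_
  rw [mul_comm]; rfl

theorem inner_toLp {f g : ℝ → EuclideanSpace ℂ (Fin p × Fin m)} (hf : MemLp f 2 volume)
    (hg : MemLp g 2 volume) :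
    inner ℂ (hf.toLp f) (hg.toLp g) = ∫ y, inner ℂ (f y) (g y) := by
  rw [L2.inner_def]
  refine integral_congr_ae ?_
  filter_upwards [hf.coeFn_toLp, hg.coeFn_toLp] with y h1 h2
  rw [h1, h2]

theorem inner_sliceLp (F G : HardyTwo p m) {ξ η : ℝ} (hξ : 0 < ξ) (hη : 0 < η) :
    inner ℂ (F.sliceLp ξ) (G.sliceLp η) =
      ∫ y, inner ℂ (verticalSlice F ξ y) (verticalSlice G η y) := by
  rw [sliceLp_of_pos F hξ, sliceLp_of_pos G hη, inner_toLp]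

theorem lintegral_enorm_inner_slice_le (F G : HardyTwo p m) {ξ η : ℝ} (hξ : 0 < ξ) (hη : 0 < η) :
    ∫⁻ y, ‖inner ℂ (verticalSlice F ξ y) (verticalSlice G η y)‖ₑ ≤
      hardyGauge F * hardyGauge G := by
  rw [← eLpNorm_one_eq_lintegral_enorm]
  refine (eLpNorm_le_eLpNorm_mul_eLpNorm'_of_norm (p := 2) (q := 2) (r := 1)
    (F.memLp_slice hξ).1 (G.memLp_slice hη).1 (fun x y => inner ℂ x y) 1
    (Eventually.of_forall fun y => ?_)).trans ?_
  · simpa using norm_inner_le_norm (𝕜 := ℂ) _ _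
  · rw [ENNReal.coe_one, one_mul]
    exact mul_le_mul' (F.eLpNorm_slice_le hξ) (G.eLpNorm_slice_le hη)

/-- Reflecting the argument of `F` in the line `Re s = (ξ + η) / 2` and conjugating makes the
integrand analytic: the function `q` restricts on `Re s = x` to the pointwise inner product of the
slices at `ξ + η - x` and `x`. Its `L¹` norms on these lines are bounded by Cauchy-Schwarz, so the
line of integration can be moved from `η` to `η'`. -/
theorem inner_sliceLp_eq_of_add_eq_of_le (F G : HardyTwo p m) {ξ η ξ' η' : ℝ} (hη : 0 < η)
    (hξ' : 0 < ξ') (h : ξ + η = ξ' + η') (hle : η ≤ η') :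
    inner ℂ (F.sliceLp ξ) (G.sliceLp η) = inner ℂ (F.sliceLp ξ') (G.sliceLp η') := by
  have hη' : 0 < η' := hη.trans_le hle
  have hξ : 0 < ξ := by linarith
  set q : ℂ → ℂ := fun s => ∑ ij : Fin p × Fin m,
    G s ij.1 ij.2 * conj (F (conj (((ξ + η : ℝ) : ℂ) - s)) ij.1 ij.2) with hq
  have hline : ∀ x y : ℝ, q (x + y * Complex.I) =
      inner ℂ (verticalSlice F (ξ + η - x) y) (verticalSlice G x y) := by
    intro x y
    have : conj (((ξ + η : ℝ) : ℂ) - (x + y * Complex.I)) =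
        ((ξ + η - x : ℝ) : ℂ) + y * Complex.I := by
      simp only [map_sub, map_add, map_mul, Complex.conj_ofReal, Complex.conj_I]
      push_cast
      ring
    simp only [hq, this, PiLp.inner_apply, RCLike.inner_apply, verticalSlice, frobeniusVec]
  have hdiff : DifferentiableOn ℂ q {s | s.re ∈ Icc η η'} := by
    have hU : IsOpen {s : ℂ | 0 < s.re} := isOpen_lt continuous_const Complex.continuous_re
    refine DifferentiableOn.fun_sum fun ij _ => DifferentiableOn.mul ?_ ?_
    · exact (G.2.1.differentiableOn ij.1 ij.2).mono fun s hs => hη.trans_le hs.1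
    · intro s hs
      have h1 : 0 < (conj (((ξ + η : ℝ) : ℂ) - s)).re := by
        have := hs.2
        simp at this ⊢
        linarith
      have h2 := ((F.2.1.differentiableOn ij.1 ij.2).differentiableAt (hU.mem_nhds h1)).conj_conj
      rw [Complex.conj_conj] at h2
      have h3 := DifferentiableAt.comp s h2
        ((differentiableAt_const ((ξ + η : ℝ) : ℂ)).sub differentiableAt_id)
      exact h3.differentiableWithinAt
  have key := integral_verticalLine_eq hle hdiff (K := hardyGauge F * hardyGauge G)
    (ENNReal.mul_lt_top F.2.2 G.2.2).ne fun x hx => by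
      simp only [hline]
      exact lintegral_enorm_inner_slice_le F G (by linarith [hx.2]) (hη.trans_le hx.1)
  simp only [hline] at key
  rw [inner_sliceLp F G hξ hη, inner_sliceLp F G hξ' hη']
  rwa [add_sub_cancel_right, h, add_sub_cancel_right] at key

theorem inner_sliceLp_eq_of_add_eq (F G : HardyTwo p m) {ξ η ξ' η' : ℝ} (hξ : 0 < ξ) (hη : 0 < η)
    (hξ' : 0 < ξ') (hη' : 0 < η') (h : ξ + η = ξ' + η') :
    inner ℂ (F.sliceLp ξ) (G.sliceLp η) = inner ℂ (F.sliceLp ξ') (G.sliceLp η') := by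
  rcases le_total η η' with hle | hle
  · exact inner_sliceLp_eq_of_add_eq_of_le F G hη hξ' h hle
  · exact (inner_sliceLp_eq_of_add_eq_of_le F G hη' hξ h.symm hle).symm

theorem exists_tendsto_sliceLp (F : HardyTwo p m) :
    ∃ l, Tendsto F.sliceLp (𝓝[>] 0) (𝓝 l) :=
  exists_tendsto_of_inner_eq_of_add_eq F.sliceLp (fun ξ _ => F.norm_sliceLp_le ξ)
    fun _ _ _ _ => inner_sliceLp_eq_of_add_eq F F

/-- The boundary function of `F`, as an element of `L²`. -/
noncomputable def boundaryLp (F : HardyTwo p m) :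
    Lp (EuclideanSpace ℂ (Fin p × Fin m)) 2 (volume : Measure ℝ) :=
  F.exists_tendsto_sliceLp.choose

theorem tendsto_sliceLp (F : HardyTwo p m) : Tendsto F.sliceLp (𝓝[>] 0) (𝓝 F.boundaryLp) :=
  F.exists_tendsto_sliceLp.choose_spec

theorem isBoundaryFunction_iff {F : HardyTwo p m} {f : ℝ → Matrix (Fin p) (Fin m) ℂ}
    (hf : MemLp (fun y => frobeniusVec (f y)) 2 volume) :
    IsBoundaryFunction F f ↔ Tendsto F.sliceLp (𝓝[>] 0) (𝓝 (hf.toLp _)) := by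
  rw [IsBoundaryFunction, and_iff_right hf, Lp.tendsto_Lp_iff_tendsto_eLpNorm']
  refine tendsto_congr' ?_
  filter_upwards [self_mem_nhdsWithin] with ξ hξ
  refine eLpNorm_congr_ae ?_
  rw [sliceLp_of_pos F hξ]
  exact ((F.memLp_slice hξ).coeFn_toLp.sub hf.coeFn_toLp).symm

theorem exists_isBoundaryFunction (F : HardyTwo p m) : ∃ f, IsBoundaryFunction F f := by
  have heq : (fun y => frobeniusVec (Matrix.of fun i j => F.boundaryLp y (i, j))) =
      fun y => F.boundaryLp y := by
    funext y; ext ij; rfl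
  have hf : MemLp (fun y => frobeniusVec (Matrix.of fun i j => F.boundaryLp y (i, j)))
      2 volume := by
    rw [heq]; exact Lp.memLp _
  refine ⟨_, (isBoundaryFunction_iff hf).2 ?_⟩
  have : hf.toLp _ = F.boundaryLp := by
    refine Lp.ext (hf.coeFn_toLp.trans ?_)
    rw [heq]
  rw [this]
  exact F.tendsto_sliceLp

theorem isBoundaryFunction_boundary (F : HardyTwo p m) : IsBoundaryFunction F F.boundary := by
  rw [boundary, dif_pos F.exists_isBoundaryFunction]
  exact F.exists_isBoundaryFunction.choose_spec

/-- Limits in `L²` are unique, so the class of the chosen boundary function does not depend on the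
choice, and inner products can be computed as limits along slices. -/
theorem toLp_boundary (F : HardyTwo p m) :
    F.isBoundaryFunction_boundary.1.toLp _ = F.boundaryLp :=
  tendsto_nhds_unique ((isBoundaryFunction_iff F.isBoundaryFunction_boundary.1).1
    F.isBoundaryFunction_boundary) F.tendsto_sliceLp

theorem innerH2_eq_inner (F G : HardyTwo p m) :
    innerH2 F G = (1 / (2 * Real.pi) : ℂ) * inner ℂ F.boundaryLp G.boundaryLp := by
  rw [innerH2, ← toLp_boundary F, ← toLp_boundary G, inner_toLp]
  simp only [inner_frobeniusVec]

theorem tendsto_inner_sliceLp (F G : HardyTwo p m) :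
    Tendsto (fun ξ => (1 / (2 * Real.pi) : ℂ) * inner ℂ (F.sliceLp ξ) (G.sliceLp ξ)) (𝓝[>] 0)
      (𝓝 (innerH2 F G)) := by
  rw [innerH2_eq_inner]
  exact (F.tendsto_sliceLp.inner G.tendsto_sliceLp).const_mul _

theorem boundaryLp_add (F G : HardyTwo p m) :
    (F + G).boundaryLp = F.boundaryLp + G.boundaryLp := by
  refine tendsto_nhds_unique (F + G).tendsto_sliceLp ?_
  rw [funext (sliceLp_add F G)]
  exact F.tendsto_sliceLp.add G.tendsto_sliceLp

theorem boundaryLp_smul (a : ℂ) (F : HardyTwo p m) :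
    (a • F).boundaryLp = a • F.boundaryLp := by
  refine tendsto_nhds_unique (a • F).tendsto_sliceLp ?_
  rw [funext (sliceLp_smul a F)]
  exact F.tendsto_sliceLp.const_smul a

theorem norm_boundaryLp_le (F : HardyTwo p m) : ‖F.boundaryLp‖ ≤ √(2 * Real.pi) * ‖F‖ :=
  le_of_tendsto F.tendsto_sliceLp.norm (Eventually.of_forall F.norm_sliceLp_le)

/-- The passage to the boundary function, as a continuous linear map into `L²`. -/
noncomputable def boundaryCLM :
    HardyTwo p m →L[ℂ] Lp (EuclideanSpace ℂ (Fin p × Fin m)) 2 (volume : Measure ℝ) :=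
  LinearMap.mkContinuous
    { toFun := boundaryLp, map_add' := boundaryLp_add, map_smul' := boundaryLp_smul }
    (√(2 * Real.pi)) norm_boundaryLp_le

/-- The functional `F ↦ ⟨G, F⟩`. -/
noncomputable def innerCLM (G : HardyTwo p m) : HardyTwo p m →L[ℂ] ℂ :=
  (1 / (2 * Real.pi) : ℂ) • (innerSL ℂ G.boundaryLp).comp boundaryCLM

theorem innerCLM_apply (G F : HardyTwo p m) : innerCLM G F = innerH2 G F :=
  (innerH2_eq_inner G F).symm

theorem innerH2_conj_symm (F G : HardyTwo p m) : conj (innerH2 G F) = innerH2 F G := by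
  have hc : (1 / (2 * Real.pi) : ℂ) = ((1 / (2 * Real.pi) : ℝ) : ℂ) := by push_cast; rfl
  rw [innerH2_eq_inner, innerH2_eq_inner, map_mul, inner_conj_symm, hc, Complex.conj_ofReal]

end HardyTwo

/-! ### Cauchy's integral formula on a vertical line -/

theorem inv_sq_add_sub_sq_eq {d : ℝ} (hd : 0 < d) (v y : ℝ) :
    (d ^ 2 + (y - v) ^ 2)⁻¹ = (d ^ 2)⁻¹ * (1 + ((y - v) / d) ^ 2)⁻¹ := by
  rw [← mul_inv]
  congr 1
  field_simp

theorem integrable_inv_sq_add_sub_sq {d : ℝ} (hd : 0 < d) (v : ℝ) :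
    Integrable fun y : ℝ => (d ^ 2 + (y - v) ^ 2)⁻¹ := by
  simp only [inv_sq_add_sub_sq_eq hd]
  exact ((integrable_inv_one_add_sq.comp_div hd.ne').comp_sub_right v).const_mul _

theorem integral_inv_sq_add_sub_sq {d : ℝ} (hd : 0 < d) (v : ℝ) :
    ∫ y : ℝ, (d ^ 2 + (y - v) ^ 2)⁻¹ = Real.pi / d := by
  simp only [inv_sq_add_sub_sq_eq hd]
  rw [integral_const_mul, integral_sub_right_eq_self (fun y : ℝ => (1 + (y / d) ^ 2)⁻¹) v,
    Measure.integral_comp_div (fun y : ℝ => (1 + y ^ 2)⁻¹) d, integral_univ_inv_one_add_sq,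
    abs_of_pos hd, smul_eq_mul]
  field_simp

theorem lintegral_inv_sq_add_sub_sq {d : ℝ} (hd : 0 < d) (v : ℝ) :
    ∫⁻ y : ℝ, ENNReal.ofReal ((d ^ 2 + (y - v) ^ 2)⁻¹) = ENNReal.ofReal (Real.pi / d) := by
  rw [← ofReal_integral_eq_lintegral_ofReal (integrable_inv_sq_add_sub_sq hd v)
    (Eventually.of_forall fun y => by positivity), integral_inv_sq_add_sub_sq hd v]

theorem sq_norm_verticalLine_sub (x y : ℝ) (μ : ℂ) :
    ‖(x : ℂ) + y * Complex.I - μ‖ ^ 2 = (x - μ.re) ^ 2 + (y - μ.im) ^ 2 := by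
  rw [← Complex.normSq_eq_norm_sq, Complex.normSq_apply]
  simp
  ring

/-- The Cauchy integral over a vertical line to the left of a zero of the function vanishes, for
functions with bounded `L²` norms on the vertical lines further to the right. -/
theorem integral_dslope_verticalLine_eq_zero {h : ℂ → ℂ} {a x : ℝ} {μ : ℂ} (hax : a < x)
    (hxμ : x < μ.re) (hh : DifferentiableOn ℂ h {s | a < s.re}) {K : ℝ≥0∞} (hK : K ≠ ⊤)
    (hbd : ∀ X, x ≤ X → ∫⁻ y : ℝ, ‖h (X + y * Complex.I)‖ₑ ^ 2 ≤ K) (hμ : h μ = 0) :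
    ∫ y : ℝ, dslope h μ (x + y * Complex.I) = 0 := by
  have hopen : IsOpen {s : ℂ | a < s.re} := isOpen_lt continuous_const Complex.continuous_re
  have hq : DifferentiableOn ℂ (dslope h μ) {s | a < s.re} :=
    (Complex.differentiableOn_dslope (hopen.mem_nhds (hax.trans hxμ))).2 hh
  have hnorm : ∀ s, s ≠ μ → ‖dslope h μ s‖ = ‖h s‖ / ‖s - μ‖ := by
    intro s hs
    rw [dslope_of_ne _ hs, slope_def_field, hμ, sub_zero, norm_div]
  have hmeas : ∀ X : ℝ, x ≤ X → Measurable fun y : ℝ => ‖h (X + y * Complex.I)‖ₑ ^ 2 := by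
    intro X hX
    have : Continuous fun y : ℝ => h (X + y * Complex.I) :=
      hh.continuousOn.comp_continuous (continuous_verticalLine X) fun y => by
        simpa using hax.trans_le hX
    exact (this.measurable.enorm).pow_const 2
  -- `dslope` removes the singularity at `μ`, so the line may be moved across `μ` and arbitrarily
  -- far to the right.
  have hstrip : ∀ X, x ≤ X →
      ∫ y : ℝ, dslope h μ (x + y * Complex.I) = ∫ y : ℝ, dslope h μ (X + y * Complex.I) := by
    intro X hX
    have hcompact : IsCompact (Icc x X ×ℂ Icc (μ.im - 1) (μ.im + 1)) :=
      isCompact_Icc.reProdIm isCompact_Icc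
    obtain ⟨C, hC⟩ := hcompact.exists_bound_of_continuousOn
      (hq.continuousOn.mono fun s hs => hax.trans_le hs.1.1)
    have hC0 : 0 ≤ |C| := abs_nonneg C
    -- At heights within `1` of `μ` the slope is bounded by compactness, and the kernel is at least
    -- `1 / 2`, hence the coefficient `2 * |C|`. At other heights `h / (s - μ)` is split by the
    -- arithmetic-geometric mean inequality, and the summand `1` pays for the part with `‖s - μ‖⁻²`.
    have hpt : ∀ t ∈ Icc x X, ∀ y : ℝ, ‖dslope h μ (t + y * Complex.I)‖ ≤
        (2 * |C| + 1) * (1 ^ 2 + (y - μ.im) ^ 2)⁻¹ + ‖h (t + y * Complex.I)‖ ^ 2 := by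
      intro t ht y
      rcases le_or_gt |y - μ.im| 1 with hy | hy
      · have h1 : ‖dslope h μ (t + y * Complex.I)‖ ≤ |C| := by
          refine (hC _ ?_).trans (le_abs_self C)
          rw [abs_le] at hy
          refine ⟨by simpa using ht, ?_⟩
          simp only [mem_preimage, Complex.add_im, Complex.ofReal_im, Complex.mul_im,
            Complex.ofReal_re, Complex.I_im, mul_one, Complex.I_re, mul_zero, add_zero, zero_add]
          constructor <;> linarith
        have hy2 : (y - μ.im) ^ 2 ≤ 1 := by
          rw [← sq_abs]; exact pow_le_one₀ (abs_nonneg _) hy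
        have h2 : 1 / 2 ≤ (1 ^ 2 + (y - μ.im) ^ 2)⁻¹ := by
          rw [one_div]
          exact inv_anti₀ (by positivity) (by linarith)
        have h3 : 0 ≤ ‖h (t + y * Complex.I)‖ ^ 2 := by positivity
        nlinarith
      · have hne : (t : ℂ) + y * Complex.I ≠ μ := by
          rintro rfl
          simp at hy
          linarith
        have hy2 : 1 ≤ (y - μ.im) ^ 2 := by
          rw [← sq_abs]; exact one_le_pow₀ hy.le
        have hsq := sq_norm_verticalLine_sub t y μ
        set n := ‖(t : ℂ) + y * Complex.I - μ‖ with hn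
        have hn0 : 0 < n := norm_pos_iff.2 (sub_ne_zero.2 hne)
        rw [hnorm _ hne]
        set w := ‖h (t + y * Complex.I)‖ with hw
        have h1 : w / n ≤ (w ^ 2 + (n ^ 2)⁻¹) / 2 := by
          have := two_mul_le_add_sq w n⁻¹
          rw [inv_pow] at this
          rw [div_eq_mul_inv]
          linarith
        have h2 : (n ^ 2)⁻¹ ≤ 2 * (1 ^ 2 + (y - μ.im) ^ 2)⁻¹ := by
          rw [← div_eq_mul_inv, inv_eq_one_div, div_le_div_iff₀ (by positivity) (by positivity)]
          nlinarith [sq_nonneg (t - μ.re)]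
        have h3 : 0 ≤ |C| * (1 ^ 2 + (y - μ.im) ^ 2)⁻¹ := by positivity
        nlinarith [sq_nonneg w]
    refine integral_verticalLine_eq hX (hq.mono fun s hs => hax.trans_le hs.1)
      (K := ENNReal.ofReal (2 * |C| + 1) * ENNReal.ofReal (Real.pi / 1) + K)
      (ENNReal.add_lt_top.2 ⟨ENNReal.mul_lt_top (by simp) (by simp), hK.lt_top⟩).ne fun t ht => ?_
    calc ∫⁻ y : ℝ, ‖dslope h μ (t + y * Complex.I)‖ₑ
        ≤ ∫⁻ y : ℝ, (ENNReal.ofReal (2 * |C| + 1) * ENNReal.ofReal ((1 ^ 2 + (y - μ.im) ^ 2)⁻¹) +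
            ‖h (t + y * Complex.I)‖ₑ ^ 2) := by
          refine lintegral_mono fun y => ?_
          rw [← ofReal_norm, ← ofReal_norm, ← ENNReal.ofReal_pow (norm_nonneg _),
            ← ENNReal.ofReal_mul (by positivity), ← ENNReal.ofReal_add (by positivity)
              (by positivity)]
          exact ENNReal.ofReal_le_ofReal (hpt t ht y)
      _ ≤ _ := by
          rw [lintegral_add_right _ (hmeas t ht.1), lintegral_const_mul' _ _ (by simp),
            lintegral_inv_sq_add_sub_sq one_pos]
          gcongr
          exact hbd t ht.1
  -- At distance `e⁻²` to the right of `μ` the integral of `‖s - μ‖⁻²` is `π e²`. Splitting `‖h‖ /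
  -- ‖s - μ‖` with weights `e` and `e⁻¹` therefore bounds the integral by `e (K + π)`.
  have hsmall : ∀ e : ℝ, 0 < e → ‖∫ y : ℝ, dslope h μ (x + y * Complex.I)‖ₑ ≤
      ENNReal.ofReal e * (K + ENNReal.ofReal Real.pi) := by
    intro e he
    have hd : 0 < (e ^ 2)⁻¹ := by positivity
    rw [hstrip (μ.re + (e ^ 2)⁻¹) (by linarith)]
    refine (enorm_integral_le_lintegral_enorm _).trans ?_
    calc ∫⁻ y : ℝ, ‖dslope h μ ((μ.re + (e ^ 2)⁻¹ : ℝ) + y * Complex.I)‖ₑ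
        ≤ ∫⁻ y : ℝ, (ENNReal.ofReal (e⁻¹) *
            ENNReal.ofReal (((e ^ 2)⁻¹ ^ 2 + (y - μ.im) ^ 2)⁻¹) +
            ENNReal.ofReal e * ‖h ((μ.re + (e ^ 2)⁻¹ : ℝ) + y * Complex.I)‖ₑ ^ 2) := by
          refine lintegral_mono fun y => ?_
          rw [← ofReal_norm, ← ofReal_norm, ← ENNReal.ofReal_pow (norm_nonneg _),
            ← ENNReal.ofReal_mul (by positivity), ← ENNReal.ofReal_mul (by positivity),
            ← ENNReal.ofReal_add (by positivity) (by positivity)]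
          refine ENNReal.ofReal_le_ofReal ?_
          have hsq := sq_norm_verticalLine_sub (μ.re + (e ^ 2)⁻¹) y μ
          rw [add_sub_cancel_left] at hsq
          set n := ‖((μ.re + (e ^ 2)⁻¹ : ℝ) : ℂ) + y * Complex.I - μ‖ with hn
          have hn2 : 0 < n ^ 2 := by rw [hsq]; positivity
          have hne : ((μ.re + (e ^ 2)⁻¹ : ℝ) : ℂ) + y * Complex.I ≠ μ := by
            rw [← sub_ne_zero, ← norm_ne_zero_iff]
            exact (pow_ne_zero_iff two_ne_zero).1 hn2.ne'
          rw [hnorm _ hne, ← hsq]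
          set w := ‖h ((μ.re + (e ^ 2)⁻¹ : ℝ) + y * Complex.I)‖ with hw
          have h1 : w / n ≤ (e⁻¹ * (n ^ 2)⁻¹ + e * w ^ 2) / 2 := by
            have := mul_nonneg he.le (sq_nonneg (w - e⁻¹ * n⁻¹))
            have h2 : e * (w - e⁻¹ * n⁻¹) ^ 2 = e * w ^ 2 - 2 * (w / n) + e⁻¹ * (n ^ 2)⁻¹ := by
              field_simp
              ring
            linarith
          have h3 : 0 ≤ e⁻¹ * (n ^ 2)⁻¹ + e * w ^ 2 := by positivity
          linarith
      _ ≤ _ := by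
          rw [lintegral_add_right _ ((hmeas _ (by linarith)).const_mul _),
            lintegral_const_mul' _ _ (by simp), lintegral_const_mul' _ _ (by simp),
            lintegral_inv_sq_add_sub_sq hd, mul_add, add_comm,
            ← ENNReal.ofReal_mul (by positivity), ← ENNReal.ofReal_mul (by positivity)]
          have : e⁻¹ * (Real.pi / (e ^ 2)⁻¹) = e * Real.pi := by field_simp
          rw [this]
          gcongr
          exact hbd _ (by linarith)
  have hlim : Tendsto (fun e : ℝ => ENNReal.ofReal e * (K + ENNReal.ofReal Real.pi)) (𝓝[>] 0)
      (𝓝 (ENNReal.ofReal 0 * (K + ENNReal.ofReal Real.pi))) :=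
    (ENNReal.Tendsto.mul_const (ENNReal.continuous_ofReal.tendsto 0)
      (Or.inr (ENNReal.add_lt_top.2 ⟨hK.lt_top, by simp⟩).ne)).mono_left nhdsWithin_le_nhds
  rw [ENNReal.ofReal_zero, zero_mul] at hlim
  rw [← enorm_eq_zero]
  exact le_antisymm (ge_of_tendsto hlim (eventually_of_mem self_mem_nhdsWithin hsmall)) bot_le

/-- Cauchy's integral formula over a vertical line, for functions with bounded `L²` norms on
vertical lines. -/
theorem integral_div_verticalLine_eq {f : ℂ → ℂ} {x : ℝ} {μ : ℂ} (hx : 0 < x) (hxμ : x < μ.re)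
    (hf : DifferentiableOn ℂ f {s : ℂ | 0 < s.re}) {K : ℝ≥0∞} (hK : K ≠ ⊤)
    (hbd : ∀ X : ℝ, 0 < X → ∫⁻ y : ℝ, ‖f (X + y * Complex.I)‖ₑ ^ 2 ≤ K) :
    Integrable (fun y : ℝ => f (x + y * Complex.I) / (μ - (x + y * Complex.I))) ∧
      ∫ y : ℝ, f (x + y * Complex.I) / (μ - (x + y * Complex.I)) = 2 * Real.pi * f μ := by
  set d : ℝ := μ.re - x with hd
  have hd0 : 0 < d := sub_pos.2 hxμ
  -- The pole of `k` is the mirror image of `μ` in the line `Re s = x`, and `k μ = 1`. Hence `f - f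
  -- μ * k` vanishes at `μ` and has bounded `L²` norms to the right, while on the line `k / (μ - s)`
  -- is a Poisson kernel with integral `2π`. The formula follows without closing a contour.
  set k : ℂ → ℂ := fun s => (2 * d : ℝ) / (s + conj μ - (2 * x : ℝ)) with hk
  have hkden : ∀ s : ℂ, max 0 (2 * x - μ.re) < s.re → s + conj μ - (2 * x : ℝ) ≠ 0 := by
    intro s hs h0
    have h1 := congrArg Complex.re h0
    have h2 := (le_max_right 0 (2 * x - μ.re)).trans_lt hs
    simp at h1
    linarith
  have hax : max 0 (2 * x - μ.re) < x := max_lt hx (by linarith)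
  have hkdiff : DifferentiableOn ℂ k {s : ℂ | max 0 (2 * x - μ.re) < s.re} := by
    intro s hs
    have h1 : DifferentiableAt ℂ (fun s : ℂ => s + conj μ - (2 * x : ℝ)) s := by fun_prop
    exact ((differentiableAt_const ((2 * d : ℝ) : ℂ)).div h1 (hkden s hs)).differentiableWithinAt
  have hkμ : k μ = 1 := by
    have h1 : μ + conj μ - (2 * x : ℝ) = (2 * d : ℝ) := by
      apply Complex.ext <;> simp [hd]
      ring
    simp only [hk]
    rw [h1, div_self]
    exact Complex.ofReal_ne_zero.2 (by positivity)
  have hknorm : ∀ X y : ℝ, x ≤ X →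
      ‖k (X + y * Complex.I)‖ ^ 2 ≤ (4 * d ^ 2) * (d ^ 2 + (y - μ.im) ^ 2)⁻¹ := by
    intro X y hX
    have h1 : (X : ℂ) + y * Complex.I + conj μ - (2 * x : ℝ) =
        X + y * Complex.I - (2 * x - conj μ) := by push_cast; ring
    simp only [hk]
    rw [norm_div, div_pow, h1, sq_norm_verticalLine_sub, Complex.norm_real, Real.norm_eq_abs,
      sq_abs, mul_pow, div_eq_mul_inv]
    have h2 : (2 * x - conj μ : ℂ).re = 2 * x - μ.re := by simp
    have h3 : (2 * x - conj μ : ℂ).im = μ.im := by simp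
    rw [h2, h3]
    have h4 : d ^ 2 ≤ (X - (2 * x - μ.re)) ^ 2 := by
      apply pow_le_pow_left₀ hd0.le
      linarith
    norm_num
    gcongr
  have hkint : ∀ y : ℝ, k (x + y * Complex.I) / (μ - (x + y * Complex.I)) =
      ((2 * d * (d ^ 2 + (y - μ.im) ^ 2)⁻¹ : ℝ) : ℂ) := by
    intro y
    have h1 : ((x : ℂ) + y * Complex.I + conj μ - (2 * x : ℝ)) * (μ - (x + y * Complex.I)) =
        ((d ^ 2 + (y - μ.im) ^ 2 : ℝ) : ℂ) := by
      apply Complex.ext <;> simp [hd, sq] <;> ring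
    simp only [hk]
    rw [div_div, h1]
    push_cast
    rfl
  have hcont : ∀ g : ℂ → ℂ, ContinuousOn g {s : ℂ | max 0 (2 * x - μ.re) < s.re} →
      ∀ X : ℝ, x ≤ X → Continuous fun y : ℝ => g (X + y * Complex.I) := by
    intro g hg X hX
    exact hg.comp_continuous (continuous_verticalLine X) fun y => by
      simpa using hax.trans_le hX
  have hden : ∀ y : ℝ, μ - (x + y * Complex.I) ≠ 0 := by
    intro y h0
    have h1 := congrArg Complex.re h0
    simp at h1
    linarith
  have hf' : DifferentiableOn ℂ f {s : ℂ | max 0 (2 * x - μ.re) < s.re} :=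
    hf.mono fun s (hs : _ < s.re) => lt_of_le_of_lt (le_max_left _ _) hs
  have hfint : Integrable fun y : ℝ => f (x + y * Complex.I) / (μ - (x + y * Complex.I)) := by
    have hfc := hcont f hf'.continuousOn x le_rfl
    refine ⟨(hfc.div (by fun_prop) hden).aestronglyMeasurable, ?_⟩
    calc ∫⁻ y : ℝ, ‖f (x + y * Complex.I) / (μ - (x + y * Complex.I))‖ₑ
        ≤ ∫⁻ y : ℝ, (ENNReal.ofReal ((d ^ 2 + (y - μ.im) ^ 2)⁻¹) +
            ‖f (x + y * Complex.I)‖ₑ ^ 2) := by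
          refine lintegral_mono fun y => ?_
          rw [← ofReal_norm, ← ofReal_norm, ← ENNReal.ofReal_pow (norm_nonneg _),
            ← ENNReal.ofReal_add (by positivity) (by positivity)]
          refine ENNReal.ofReal_le_ofReal ?_
          have hsq := sq_norm_verticalLine_sub x y μ
          have h1 : (x - μ.re) ^ 2 = d ^ 2 := by rw [hd]; ring
          rw [norm_div, norm_sub_rev μ, ← h1, ← hsq, ← inv_pow]
          have h2 := two_mul_le_add_sq ‖f (x + y * Complex.I)‖ ‖(x : ℂ) + y * Complex.I - μ‖⁻¹
          have h3 : 0 ≤ ‖f (x + y * Complex.I)‖ * ‖(x : ℂ) + y * Complex.I - μ‖⁻¹ := by positivity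
          rw [div_eq_mul_inv]
          linarith
      _ < ⊤ := by
          rw [lintegral_add_right _ (hfc.measurable.enorm.pow_const 2),
            lintegral_inv_sq_add_sub_sq hd0]
          exact ENNReal.add_lt_top.2 ⟨by simp, (hbd x hx).trans_lt hK.lt_top⟩
  refine ⟨hfint, ?_⟩
  set h : ℂ → ℂ := fun s => f s - f μ * k s with hh
  have hzero := integral_dslope_verticalLine_eq_zero (h := h) hax hxμ
    (hf'.sub (hkdiff.const_mul (f μ)))
    (K := 2 * (K + ‖f μ‖ₑ ^ 2 * (ENNReal.ofReal (4 * d ^ 2) * ENNReal.ofReal (Real.pi / d))))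
    (ENNReal.mul_lt_top (by simp) (ENNReal.add_lt_top.2 ⟨hK.lt_top, ENNReal.mul_lt_top (by simp)
      (ENNReal.mul_lt_top ENNReal.ofReal_lt_top ENNReal.ofReal_lt_top)⟩)).ne (fun X hX => by
      calc ∫⁻ y : ℝ, ‖h (X + y * Complex.I)‖ₑ ^ 2
          ≤ ∫⁻ y : ℝ, 2 * (‖f (X + y * Complex.I)‖ₑ ^ 2 + ‖f μ‖ₑ ^ 2 *
              (ENNReal.ofReal (4 * d ^ 2) * ENNReal.ofReal ((d ^ 2 + (y - μ.im) ^ 2)⁻¹))) := by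
            refine lintegral_mono fun y => ?_
            simp only [← ofReal_norm]
            rw [← ENNReal.ofReal_pow (norm_nonneg _), ← ENNReal.ofReal_pow (norm_nonneg _),
              ← ENNReal.ofReal_pow (norm_nonneg _), ← ENNReal.ofReal_mul (by positivity),
              ← ENNReal.ofReal_mul (by positivity), ← ENNReal.ofReal_add (by positivity)
                (by positivity), ← ENNReal.ofReal_ofNat 2, ← ENNReal.ofReal_mul (by positivity)]
            refine ENNReal.ofReal_le_ofReal ?_
            have h1 : ‖h (X + y * Complex.I)‖ ≤
                ‖f (X + y * Complex.I)‖ + ‖f μ‖ * ‖k (X + y * Complex.I)‖ := by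
              rw [← norm_mul]; exact norm_sub_le _ _
            have h2 := mul_le_mul_of_nonneg_left (hknorm X y hX) (sq_nonneg ‖f μ‖)
            have h3 := pow_le_pow_left₀ (norm_nonneg _) h1 2
            have h4 := add_sq_le (a := ‖f (X + y * Complex.I)‖)
              (b := ‖f μ‖ * ‖k (X + y * Complex.I)‖)
            rw [mul_pow] at h4
            linarith
        _ ≤ _ := by
            have hm : Measurable fun y : ℝ => ‖f (X + y * Complex.I)‖ₑ ^ 2 :=
              (hcont f hf'.continuousOn X hX).measurable.enorm.pow_const 2
            rw [lintegral_const_mul' _ _ (by simp), lintegral_add_left hm,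
              lintegral_const_mul' _ _ (by simp), lintegral_const_mul' _ _ ENNReal.ofReal_ne_top,
              lintegral_inv_sq_add_sub_sq hd0]
            gcongr
            exact hbd X (hx.trans_le hX))
    (by simp [hh, hkμ])
  have hds : ∀ y : ℝ, dslope h μ (x + y * Complex.I) =
      f μ * (k (x + y * Complex.I) / (μ - (x + y * Complex.I))) -
        f (x + y * Complex.I) / (μ - (x + y * Complex.I)) := by
    intro y
    have hne : (x : ℂ) + y * Complex.I ≠ μ := fun h0 => hden y (sub_eq_zero.2 h0.symm)
    have hne' := hden y
    rw [dslope_of_ne _ hne, slope_def_field]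
    have h1 : h μ = 0 := by simp [hh, hkμ]
    rw [h1, sub_zero, ← neg_sub μ, div_neg]
    simp only [hh]
    ring
  have hkI : Integrable fun y : ℝ => k (x + y * Complex.I) / (μ - (x + y * Complex.I)) := by
    simp only [hkint]
    exact ((integrable_inv_sq_add_sub_sq hd0 μ.im).const_mul (2 * d)).ofReal
  simp only [hds] at hzero
  rw [integral_sub (hkI.const_mul _) hfint, integral_const_mul] at hzero
  simp only [hkint] at hzero
  rw [integral_complex_ofReal, integral_const_mul, integral_inv_sq_add_sub_sq hd0] at hzero
  have h2 : 2 * d * (Real.pi / d) = 2 * Real.pi := by field_simp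
  rw [h2] at hzero
  push_cast at hzero
  linear_combination -hzero

/-! ### Entry bounds and Taylor estimates for poles -/

theorem frobeniusVec_smul {p m : ℕ} (a : ℂ) (M : Matrix (Fin p) (Fin m) ℂ) :
    frobeniusVec (a • M) = a • frobeniusVec M := rfl

theorem norm_entry_le_norm_frobeniusVec {p m : ℕ} (M : Matrix (Fin p) (Fin m) ℂ) (i : Fin p)
    (j : Fin m) : ‖M i j‖ ≤ ‖frobeniusVec M‖ :=
  PiLp.norm_apply_le (frobeniusVec M) (i, j)

theorem eLpNorm_two_sq_eq_lintegral {E : Type*} [NormedAddCommGroup E] (f : ℝ → E) :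
    eLpNorm f 2 volume ^ 2 = ∫⁻ y, ‖f y‖ₑ ^ 2 := by
  rw [eLpNorm_eq_lintegral_rpow_enorm_toReal (by norm_num) (by norm_num), ← ENNReal.rpow_natCast,
    ← ENNReal.rpow_mul]
  norm_num

/-- Second-order Taylor estimate for `z ↦ z⁻ⁿ⁻¹`. -/
theorem exists_norm_inv_pow_sub_le {d : ℝ} (hd : 0 < d) (n : ℕ) : ∃ C : ℝ, 0 ≤ C ∧
    ∀ z h : ℂ, d ≤ ‖z‖ → ‖h‖ ≤ d / 2 →
      ‖((z - h) ^ (n + 1))⁻¹ - (z ^ (n + 1))⁻¹ - h * ((n + 1) * (z ^ (n + 2))⁻¹)‖ ≤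
        C * ‖h‖ ^ 2 * ‖z‖⁻¹ := by
  have hbasic : ∀ z h : ℂ, d ≤ ‖z‖ → ‖h‖ ≤ d / 2 →
      z ≠ 0 ∧ z - h ≠ 0 ∧ ‖(z - h)⁻¹‖ ≤ 2 / d ∧ ‖z⁻¹‖ ≤ 1 / d := by
    intro z h hz hh
    have h1 : d / 2 ≤ ‖z - h‖ := by
      have := norm_sub_norm_le z h
      linarith
    refine ⟨norm_pos_iff.1 (hd.trans_le hz), norm_pos_iff.1 (by linarith), ?_, ?_⟩
    · rw [norm_inv, ← inv_div]
      exact inv_anti₀ (by positivity) h1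
    · rw [norm_inv, one_div]
      exact inv_anti₀ hd hz
  -- One factor `‖z‖⁻¹` is kept in the remainder because it makes the remainder square integrable on
  -- vertical lines; the other inverses are bounded in terms of `d`. The induction step multiplies
  -- the previous remainder by `(z - h)⁻¹` and adds an explicit quadratic term.
  induction n with
  | zero =>
    refine ⟨2 / d * (1 / d), by positivity, fun z h hz hh => ?_⟩
    obtain ⟨hz0, hzh, hw, hv⟩ := hbasic z h hz hh
    have key : ((z - h) ^ (0 + 1))⁻¹ - (z ^ (0 + 1))⁻¹ - h * (((0 : ℕ) + 1) * (z ^ (0 + 2))⁻¹) =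
        (z - h)⁻¹ * z⁻¹ * h ^ 2 * z⁻¹ := by
      push_cast
      field_simp
      ring
    rw [key, norm_mul, norm_mul, norm_mul, norm_pow, norm_inv z]
    rw [norm_inv z] at hv
    gcongr
  | succ n ih =>
    obtain ⟨C, hC0, hC⟩ := ih
    refine ⟨2 / d * C + (n + 2) * (2 / d) * (1 / d) ^ (n + 2), by positivity, fun z h hz hh => ?_⟩
    obtain ⟨hz0, hzh, hw, hv⟩ := hbasic z h hz hh
    have key : ((z - h) ^ (n + 1 + 1))⁻¹ - (z ^ (n + 1 + 1))⁻¹ -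
          h * (((n + 1 : ℕ) + 1) * (z ^ (n + 1 + 2))⁻¹) =
        (z - h)⁻¹ * (((z - h) ^ (n + 1))⁻¹ - (z ^ (n + 1))⁻¹ -
          h * ((n + 1) * (z ^ (n + 2))⁻¹)) +
        (n + 2) * (z - h)⁻¹ * (z ^ (n + 2))⁻¹ * h ^ 2 * z⁻¹ := by
      push_cast
      rw [pow_succ (z - h) (n + 1), mul_inv]
      generalize ((z - h) ^ (n + 1))⁻¹ = W
      field_simp
      ring
    have hfst : ‖(z - h)⁻¹ * (((z - h) ^ (n + 1))⁻¹ - (z ^ (n + 1))⁻¹ -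
        h * ((n + 1) * (z ^ (n + 2))⁻¹))‖ ≤ 2 / d * (C * ‖h‖ ^ 2 * ‖z‖⁻¹) := by
      rw [norm_mul]
      exact mul_le_mul hw (hC z h hz hh) (norm_nonneg _) (by positivity)
    have hsnd : ‖(n + 2) * (z - h)⁻¹ * (z ^ (n + 2))⁻¹ * h ^ 2 * z⁻¹‖ ≤
        (n + 2) * (2 / d) * (1 / d) ^ (n + 2) * ‖h‖ ^ 2 * ‖z‖⁻¹ := by
      have hn : ‖(n : ℂ) + 2‖ = n + 2 := by
        have : (n : ℂ) + 2 = ((n + 2 : ℕ) : ℂ) := by push_cast; rfl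
        rw [this, Complex.norm_natCast]
        push_cast
        rfl
      rw [← inv_pow, norm_mul, norm_mul, norm_mul, norm_mul, norm_pow, norm_pow, hn]
      rw [norm_inv z] at hv ⊢
      gcongr
    rw [key]
    refine ((norm_add_le _ _).trans (add_le_add hfst hsnd)).trans_eq ?_
    ring

/-! ### Poles as reproducing kernels -/

namespace HardyTwo

variable {p m : ℕ}

theorem lintegral_entry_sq_le (F : HardyTwo p m) (i : Fin p) (j : Fin m) {ξ : ℝ} (hξ : 0 < ξ) :
    ∫⁻ y : ℝ, ‖F (ξ + y * Complex.I) i j‖ₑ ^ 2 ≤ hardyGauge F ^ 2 := by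
  refine le_trans ?_ (pow_le_pow_left₀ bot_le (F.eLpNorm_slice_le hξ) 2)
  rw [eLpNorm_two_sq_eq_lintegral]
  refine lintegral_mono fun y => pow_le_pow_left₀ bot_le ?_ 2
  exact enorm_le_iff_norm_le.2 (norm_entry_le_norm_frobeniusVec _ i j)

/-- The functions with a simple pole reproduce the values of the elements of the Hardy space. -/
theorem innerH2_eq_of_simple_pole {G : HardyTwo p m} {l : ℂ} (hl : l.re < 0)
    {M : Matrix (Fin p) (Fin m) ℂ} (hG : ∀ s : ℂ, 0 < s.re → G s = (s - l)⁻¹ • M)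
    (F : HardyTwo p m) : innerH2 G F = (Mᴴ * F (-conj l)).trace := by
  have hpi : (2 * Real.pi : ℂ) ≠ 0 := by
    exact_mod_cast (by positivity : (2 * Real.pi : ℝ) ≠ 0)
  -- On `Re s = ξ` the conjugate of `s - l` is `2ξ - conj l - s`, so the slice inner product is a
  -- Cauchy integral for the point `2ξ - conj l`, which lies to the right of the line and tends to
  -- `-conj l`.
  have hslice : ∀ ξ : ℝ, 0 < ξ → (1 / (2 * Real.pi) : ℂ) * inner ℂ (G.sliceLp ξ) (F.sliceLp ξ) =
      ∑ ij : Fin p × Fin m, conj (M ij.1 ij.2) * F ((2 * ξ : ℝ) - conj l) ij.1 ij.2 := by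
    intro ξ hξ
    have hlt : ξ < ((2 * ξ : ℝ) - conj l : ℂ).re := by
      simp
      linarith
    have hcauchy := fun ij : Fin p × Fin m => integral_div_verticalLine_eq hξ hlt
      (F.2.1.differentiableOn ij.1 ij.2) (ENNReal.pow_lt_top F.2.2).ne
      (fun X hX => F.lintegral_entry_sq_le ij.1 ij.2 hX)
    rw [inner_sliceLp G F hξ hξ]
    have hpt : ∀ y : ℝ, inner ℂ (verticalSlice G ξ y) (verticalSlice F ξ y) =
        ∑ ij : Fin p × Fin m, conj (M ij.1 ij.2) * (F (ξ + y * Complex.I) ij.1 ij.2 /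
          (((2 * ξ : ℝ) - conj l : ℂ) - (ξ + y * Complex.I))) := by
      intro y
      have hre : 0 < ((ξ : ℂ) + y * Complex.I).re := by simpa using hξ
      simp only [PiLp.inner_apply, RCLike.inner_apply, verticalSlice, frobeniusVec, hG _ hre,
        Matrix.smul_apply, smul_eq_mul, map_mul, map_inv₀, map_sub, map_add, Complex.conj_ofReal,
        Complex.conj_I]
      refine Finset.sum_congr rfl fun ij _ => ?_
      have : ((2 * ξ : ℝ) - conj l : ℂ) - (ξ + y * Complex.I) =
          (ξ : ℂ) + y * -Complex.I - conj l := by push_cast; ring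
      rw [this]
      ring
    simp only [hpt]
    rw [integral_finsetSum _ fun ij _ => (hcauchy ij).1.const_mul _, Finset.mul_sum]
    refine Finset.sum_congr rfl fun ij _ => ?_
    rw [integral_const_mul, (hcauchy ij).2]
    field_simp
  have hU : IsOpen {s : ℂ | 0 < s.re} := isOpen_lt continuous_const Complex.continuous_re
  have hlim : Tendsto (fun ξ : ℝ => ∑ ij : Fin p × Fin m,
      conj (M ij.1 ij.2) * F ((2 * ξ : ℝ) - conj l) ij.1 ij.2) (𝓝[>] 0)
      (𝓝 (∑ ij : Fin p × Fin m, conj (M ij.1 ij.2) * F (-conj l) ij.1 ij.2)) := by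
    refine tendsto_finsetSum _ fun ij _ => Tendsto.const_mul _ ?_
    have h1 : ContinuousAt (fun s => F s ij.1 ij.2) (-conj l) :=
      (F.2.1.differentiableOn ij.1 ij.2).continuousOn.continuousAt
        (hU.mem_nhds (by simpa using hl))
    have h2 : Tendsto (fun ξ : ℝ => ((2 * ξ : ℝ) : ℂ) - conj l) (𝓝 0) (𝓝 (-conj l)) := by
      have : Continuous fun ξ : ℝ => ((2 * ξ : ℝ) : ℂ) - conj l := by fun_prop
      simpa using this.tendsto 0
    exact h1.tendsto.comp (h2.mono_left nhdsWithin_le_nhds)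
  have htend := (tendsto_inner_sliceLp G F).congr' (by
    filter_upwards [self_mem_nhdsWithin] with ξ hξ using hslice ξ hξ)
  rw [tendsto_nhds_unique htend hlim, Fintype.sum_prod_type_right]
  simp only [Matrix.trace, Matrix.diag, Matrix.mul_apply, Matrix.conjTranspose_apply]
  rfl

theorem norm_sub_ge_neg_re {s l : ℂ} (hs : 0 < s.re) : -l.re ≤ ‖s - l‖ := by
  have := (le_abs_self _).trans (Complex.abs_re_le_norm (s - l))
  simp at this
  linarith

/-- Comparison with a scalar simple pole: the squared `L²` norm of `1 / (s - l)` on `Re s = ξ` is `π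
/ (ξ - Re l)`, at most `π / (-Re l)`. -/
theorem hardyGauge_le_of_norm_le {F : ℂ → Matrix (Fin p) (Fin m) ℂ} {l : ℂ} (hl : l.re < 0)
    {C : ℝ} (hC : 0 ≤ C)
    (h : ∀ s : ℂ, 0 < s.re → ‖frobeniusVec (F s)‖ ≤ C * ‖s - l‖⁻¹) :
    hardyGauge F ≤ ENNReal.ofReal (C * √(Real.pi / -l.re)) := by
  have hl' : 0 < -l.re := neg_pos.2 hl
  refine iSup_le fun ⟨ξ, (hξ : 0 < ξ)⟩ => ?_
  refine (ENNReal.pow_le_pow_left_iff two_ne_zero).1 ?_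
  rw [eLpNorm_two_sq_eq_lintegral, ← ENNReal.ofReal_pow (by positivity), mul_pow,
    Real.sq_sqrt (by positivity), ENNReal.ofReal_mul (by positivity),
    ← lintegral_inv_sq_add_sub_sq hl' l.im, ← lintegral_const_mul' _ _ ENNReal.ofReal_ne_top]
  refine lintegral_mono fun y => ?_
  rw [← ofReal_norm, ← ENNReal.ofReal_pow (norm_nonneg _), ← ENNReal.ofReal_mul (by positivity)]
  refine ENNReal.ofReal_le_ofReal ?_
  have hre : 0 < ((ξ : ℂ) + y * Complex.I).re := by simpa using hξ
  refine (pow_le_pow_left₀ (norm_nonneg _) (h _ hre) 2).trans ?_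
  rw [mul_pow, inv_pow, sq_norm_verticalLine_sub]
  gcongr
  linarith

theorem norm_le_of_norm_le {F : HardyTwo p m} {l : ℂ} (hl : l.re < 0) {C : ℝ} (hC : 0 ≤ C)
    (h : ∀ s : ℂ, 0 < s.re → ‖frobeniusVec (F s)‖ ≤ C * ‖s - l‖⁻¹) :
    ‖F‖ ≤ C * √(Real.pi / -l.re) := by
  have hl' : 0 < -l.re := neg_pos.2 hl
  have h1 := ENNReal.toReal_mono ENNReal.ofReal_ne_top (hardyGauge_le_of_norm_le hl hC h)
  rw [ENNReal.toReal_ofReal (by positivity)] at h1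
  rw [norm_def]
  refine (mul_le_of_le_one_left ENNReal.toReal_nonneg (inv_le_one_of_one_le₀ ?_)).trans h1
  rw [Real.one_le_sqrt]
  linarith [Real.pi_gt_three]

open Classical in
/-- The function `s ↦ (s - l)⁻ⁿ⁻¹ M` on the half-plane. -/
noncomputable def poleFun (l : ℂ) (n : ℕ) (M : Matrix (Fin p) (Fin m) ℂ) (s : ℂ) :
    Matrix (Fin p) (Fin m) ℂ :=
  if 0 < s.re then ((s - l) ^ (n + 1))⁻¹ • M else 0

theorem poleFun_mem {l : ℂ} (hl : l.re < 0) (n : ℕ) (M : Matrix (Fin p) (Fin m) ℂ) :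
    poleFun l n M ∈ hardySubmodule p m := by
  have hl' : 0 < -l.re := neg_pos.2 hl
  refine ⟨⟨fun i j => ?_, fun s hs => if_neg hs.not_gt⟩, ?_⟩
  · have h1 : DifferentiableOn ℂ (fun s => ((s - l) ^ (n + 1))⁻¹ * M i j) {s | 0 < s.re} := by
      intro s hs
      have hne : (s - l) ^ (n + 1) ≠ 0 :=
        pow_ne_zero _ (norm_pos_iff.1 (hl'.trans_le (norm_sub_ge_neg_re hs)))
      have h2 : DifferentiableAt ℂ (fun s : ℂ => (s - l) ^ (n + 1)) s := by fun_prop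
      exact ((h2.fun_inv hne).mul_const _).differentiableWithinAt
    refine h1.congr fun s hs => ?_
    have h2 : poleFun l n M s = ((s - l) ^ (n + 1))⁻¹ • M := if_pos hs
    rw [h2]
    rfl
  · refine (hardyGauge_le_of_norm_le hl (C := (-l.re)⁻¹ ^ n * ‖frobeniusVec M‖)
      (by positivity) fun s hs => ?_).trans_lt ENNReal.ofReal_lt_top
    rw [poleFun, if_pos hs, frobeniusVec_smul, norm_smul, norm_inv, norm_pow, pow_succ, mul_inv,
      ← inv_pow, mul_right_comm]
    have := norm_sub_ge_neg_re (l := l) hs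
    gcongr

open Classical in
/-- The element `s ↦ (s - l)⁻ⁿ⁻¹ M` of the Hardy space (zero unless `Re l < 0`). -/
noncomputable def pole (l : ℂ) (n : ℕ) (M : Matrix (Fin p) (Fin m) ℂ) : HardyTwo p m :=
  if hl : l.re < 0 then ⟨poleFun l n M, poleFun_mem hl n M⟩ else 0

theorem pole_apply {l : ℂ} (hl : l.re < 0) (n : ℕ) (M : Matrix (Fin p) (Fin m) ℂ) {s : ℂ}
    (hs : 0 < s.re) : pole l n M s = ((s - l) ^ (n + 1))⁻¹ • M := by
  have h : pole l n M = ⟨poleFun l n M, poleFun_mem hl n M⟩ := dif_pos hl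
  rw [h]
  exact if_pos hs

theorem add_apply (F G : HardyTwo p m) (s : ℂ) : (F + G) s = F s + G s := rfl

theorem sub_apply (F G : HardyTwo p m) (s : ℂ) : (F - G) s = F s - G s := rfl

theorem smul_apply (a : ℂ) (F : HardyTwo p m) (s : ℂ) : (a • F) s = a • F s := rfl

theorem real_smul_apply (a : ℝ) (F : HardyTwo p m) (s : ℂ) : (a • F) s = (a : ℂ) • F s := rfl

theorem sum_apply {ι : Type*} (S : Finset ι) (F : ι → HardyTwo p m) (s : ℂ) :
    (∑ i ∈ S, F i) s = ∑ i ∈ S, F i s := by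
  classical
  induction S using Finset.induction_on with
  | empty => rfl
  | insert a S ha ih => rw [Finset.sum_insert ha, Finset.sum_insert ha, add_apply, ih]

theorem innerH2_pole_zero {l : ℂ} (hl : l.re < 0) (M : Matrix (Fin p) (Fin m) ℂ)
    (F : HardyTwo p m) : innerH2 (pole l 0 M) F = (Mᴴ * F (-conj l)).trace :=
  innerH2_eq_of_simple_pole hl (fun s hs => by rw [pole_apply hl 0 M hs]; simp) F

/-- Moving the pole differentiates to a pole of higher order. -/
theorem hasDerivAt_pole (l : ℂ) (n : ℕ) (M : Matrix (Fin p) (Fin m) ℂ) {t₀ : ℝ}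
    (ht₀ : (l + t₀).re < 0) :
    HasDerivAt (fun t : ℝ => pole (l + t) n M) (((n : ℂ) + 1) • pole (l + t₀) (n + 1) M) t₀ := by
  set d : ℝ := -(l + t₀).re with hd
  have hd0 : 0 < d := neg_pos.2 ht₀
  obtain ⟨C, hC0, hC⟩ := exists_norm_inv_pow_sub_le hd0 n
  rw [hasDerivAt_iff_isLittleO]
  refine (Asymptotics.IsBigO.of_bound (C * ‖frobeniusVec M‖ * √(Real.pi / -(l + t₀).re)) ?_ :
    _ =O[𝓝 t₀] fun t => (t - t₀) ^ 2).trans_isLittleO ?_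
  · have hnear : ∀ᶠ t in 𝓝 t₀, |t - t₀| < d / 2 := by
      filter_upwards [Metric.ball_mem_nhds t₀ (half_pos hd0)] with t ht
      rwa [Metric.mem_ball, Real.dist_eq] at ht
    filter_upwards [hnear] with t ht
    have hlt : (l + t).re < 0 := by
      have h1 := (le_abs_self _).trans_lt ht
      simp at hd ⊢
      linarith
    -- The scalar Taylor estimate is applied with `z = s - (l + t₀)` and `h = t - t₀`. It is uniform
    -- over the half-plane, where `‖z‖` is at least `d`, so it becomes an estimate in the Hardy
    -- norm.
    have hb := norm_le_of_norm_le
      (F := pole (l + t) n M - pole (l + t₀) n M -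
        (t - t₀) • (((n : ℂ) + 1) • pole (l + t₀) (n + 1) M)) ht₀
      (C := C * ‖frobeniusVec M‖ * ‖(t - t₀) ^ 2‖) (by positivity) fun s hs => by
        have hdiff : ((s - (l + t)) ^ (n + 1))⁻¹ • M - ((s - (l + t₀)) ^ (n + 1))⁻¹ • M -
            ((t - t₀ : ℝ) : ℂ) • ((n : ℂ) + 1) • ((s - (l + t₀)) ^ (n + 1 + 1))⁻¹ • M =
            (((s - (l + t₀) - ((t - t₀ : ℝ) : ℂ)) ^ (n + 1))⁻¹ - ((s - (l + t₀)) ^ (n + 1))⁻¹ -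
              ((t - t₀ : ℝ) : ℂ) * (((n : ℂ) + 1) * ((s - (l + t₀)) ^ (n + 2))⁻¹)) • M := by
          have : s - (l + t) = s - (l + t₀) - ((t - t₀ : ℝ) : ℂ) := by push_cast; ring
          rw [this, sub_smul, sub_smul, mul_smul, mul_smul]
        have hz : d ≤ ‖s - (l + t₀)‖ := norm_sub_ge_neg_re hs
        have hh : ‖((t - t₀ : ℝ) : ℂ)‖ ≤ d / 2 := by
          rw [Complex.norm_real]; exact ht.le
        rw [sub_apply, sub_apply, real_smul_apply, smul_apply, pole_apply hlt n M hs,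
          pole_apply ht₀ n M hs, pole_apply ht₀ (n + 1) M hs, hdiff, frobeniusVec_smul, norm_smul]
        refine (mul_le_mul_of_nonneg_right (hC _ _ hz hh) (norm_nonneg _)).trans_eq ?_
        rw [Complex.norm_real, norm_pow]
        ring
    refine hb.trans_eq ?_
    ring
  · simpa only [Real.norm_eq_abs, sq_abs] using
      Asymptotics.isLittleO_pow_sub_sub t₀ one_lt_two

/-- Each derivative is a multiple of a pole of the next order, so smoothness follows by induction
over all orders `n` at once. -/
theorem contDiffOn_pole (l : ℂ) (n : ℕ) (M : Matrix (Fin p) (Fin m) ℂ) :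
    ContDiffOn ℝ ∞ (fun t : ℝ => pole (l + t) n M) {t | (l + t).re < 0} := by
  have hopen : IsOpen {t : ℝ | (l + t).re < 0} :=
    isOpen_lt (Complex.continuous_re.comp (by fun_prop)) continuous_const
  refine contDiffOn_infty.2 fun N => ?_
  induction N generalizing n with
  | zero =>
    exact contDiffOn_zero.2 fun t ht => (hasDerivAt_pole l n M ht).continuousAt.continuousWithinAt
  | succ N ih =>
    push_cast
    rw [contDiffOn_succ_iff_deriv_of_isOpen hopen]
    refine ⟨fun t ht => (hasDerivAt_pole l n M ht).differentiableAt.differentiableWithinAt,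
      by simp, ?_⟩
    refine ContDiffOn.congr (f := fun t : ℝ => ((n : ℂ) + 1) • pole (l + t) (n + 1) M)
      ((ih (n + 1)).const_smul _) fun t ht => (hasDerivAt_pole l n M ht).deriv

/-- The functions with a double pole reproduce the derivatives. -/
theorem innerH2_pole_one {l : ℂ} (hl : l.re < 0) (M : Matrix (Fin p) (Fin m) ℂ)
    (F : HardyTwo p m) :
    innerH2 (pole l 1 M) F = -(Mᴴ * matrixDeriv F (-conj l)).trace := by
  have hl0 : (l + (0 : ℝ)).re < 0 := by simpa using hl
  have hU : IsOpen {s : ℂ | 0 < s.re} := isOpen_lt continuous_const Complex.continuous_re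
  -- The simple-pole formula is differentiated in the position of the pole. The moving pole is first
  -- put into the linear slot, where the inner product is a continuous functional, and the result is
  -- conjugated. The minus sign comes from `-conj (l + t)` having velocity `-1`.
  have h1 : HasDerivAt (fun t : ℝ => innerH2 F (pole (l + t) 0 M))
      (innerH2 F (pole l 1 M)) 0 := by
    have := ((innerCLM F).restrictScalars ℝ).hasFDerivAt.comp_hasDerivAt (0 : ℝ)
      (hasDerivAt_pole l 0 M hl0)
    simpa [Function.comp_def, innerCLM_apply] using this
  have h2 : HasDerivAt (fun t : ℝ => innerH2 (pole (l + t) 0 M) F)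
      (innerH2 (pole l 1 M) F) 0 := by
    have := h1.star
    simpa [innerH2_conj_symm] using this
  have h3 : HasDerivAt (fun t : ℝ => (Mᴴ * F (-conj (l + t))).trace)
      (-(Mᴴ * matrixDeriv F (-conj l)).trace) 0 := by
    simp only [Matrix.trace, Matrix.diag, Matrix.mul_apply, ← Finset.sum_neg_distrib]
    refine HasDerivAt.fun_sum fun j _ => HasDerivAt.fun_sum fun i _ => ?_
    rw [← mul_neg]
    refine HasDerivAt.const_mul _ ?_
    have h4 : HasDerivAt (fun s => F s i j) (matrixDeriv F (-conj l) i j) (-conj l) :=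
      ((F.2.1.differentiableOn i j).differentiableAt
        (hU.mem_nhds (by simpa using hl))).hasDerivAt
    have h5 : HasDerivAt (fun t : ℝ => -conj (l + t)) (-1) 0 := by
      have : (fun t : ℝ => -conj (l + t)) = fun t : ℝ => -conj l - (t : ℂ) := by
        funext t
        simp only [map_add, Complex.conj_ofReal]
        ring
      rw [this]
      exact (Complex.ofRealCLM.hasDerivAt (x := (0 : ℝ))).const_sub _
    have h6 : HasDerivAt (fun s => F s i j) (matrixDeriv F (-conj l) i j)
        (-conj (l + ((0 : ℝ) : ℂ))) := by simpa using h4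
    simpa [Function.comp_def] using h6.comp_of_eq (0 : ℝ) h5 rfl
  refine h2.unique (h3.congr_of_eventuallyEq ?_)
  have hopen : IsOpen {t : ℝ | (l + t).re < 0} :=
    isOpen_lt (Complex.continuous_re.comp (by fun_prop)) continuous_const
  filter_upwards [hopen.mem_nhds hl0] with t ht
  exact innerH2_pole_zero ht M F

/-- The functions orthogonal to `F`. -/
noncomputable def orthogonalSubmodule (F : HardyTwo p m) : Submodule ℂ (HardyTwo p m) :=
  LinearMap.ker (innerCLM F).toLinearMap

/-- The kernel is that of `⟨F, ·⟩`, which is linear; conjugate symmetry turns it into the condition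
`⟨·, F⟩ = 0` of the theorem. -/
theorem mem_orthogonalSubmodule {F G : HardyTwo p m} :
    G ∈ orthogonalSubmodule F ↔ innerH2 G F = 0 := by
  rw [← innerH2_conj_symm, map_eq_zero, orthogonalSubmodule, LinearMap.mem_ker,
    ← innerCLM_apply]
  rfl

/-- Point evaluations are differentiable along differentiable curves in the Hardy space. -/
theorem hasDerivAt_apply {c : ℝ → HardyTwo p m} {G : HardyTwo p m} {t₀ : ℝ}
    (hc : HasDerivAt c G t₀) {s : ℂ} (hs : 0 < s.re) (i : Fin p) (j : Fin m) :
    HasDerivAt (fun t => c t s i j) (G s i j) t₀ := by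
  -- The reproducing property with a matrix unit makes the evaluation of an entry a continuous
  -- linear functional.
  have heval : ∀ F : HardyTwo p m, innerCLM (pole (-conj s) 0 (Matrix.single i j 1)) F =
      F s i j := by
    intro F
    rw [innerCLM_apply, innerH2_pole_zero (by simpa using hs), Matrix.conjTranspose_single,
      Matrix.trace_single_mul]
    simp
  have := ((innerCLM (pole (-conj s) 0 (Matrix.single i j 1))).restrictScalars
    ℝ).hasFDerivAt.comp_hasDerivAt t₀ hc
  simpa only [Function.comp_def, ContinuousLinearMap.coe_restrictScalars', heval] using this

end HardyTwo

/-! ### Resolvents -/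

theorem isUnit_smul_one_sub {n : ℕ} {A : Matrix (Fin n) (Fin n) ℂ} {s : ℂ}
    (hs : s ∉ spectrum ℂ A) : IsUnit (s • (1 : Matrix (Fin n) (Fin n) ℂ) - A) := by
  rwa [spectrum.notMem_iff, Algebra.algebraMap_eq_smul_one] at hs

theorem isUnit_det_smul_one_sub {n : ℕ} {A : Matrix (Fin n) (Fin n) ℂ} {s : ℂ}
    (hs : s ∉ spectrum ℂ A) : IsUnit (s • (1 : Matrix (Fin n) (Fin n) ℂ) - A).det :=
  (Matrix.isUnit_iff_isUnit_det _).1 (isUnit_smul_one_sub hs)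

theorem resolvent_sub_eq {n : ℕ} {A : Matrix (Fin n) (Fin n) ℂ} {s t : ℂ}
    (hs : s ∉ spectrum ℂ A) (ht : t ∉ spectrum ℂ A) :
    (t • (1 : Matrix (Fin n) (Fin n) ℂ) - A)⁻¹ - (s • (1 : Matrix (Fin n) (Fin n) ℂ) - A)⁻¹ =
      (s - t) • ((s • (1 : Matrix (Fin n) (Fin n) ℂ) - A)⁻¹ *
        (t • (1 : Matrix (Fin n) (Fin n) ℂ) - A)⁻¹) := by
  have h1 : (s - t) • (1 : Matrix (Fin n) (Fin n) ℂ) =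
      (s • (1 : Matrix (Fin n) (Fin n) ℂ) - A) - (t • (1 : Matrix (Fin n) (Fin n) ℂ) - A) := by
    rw [sub_smul]; abel
  have h2 : (s - t) • ((s • (1 : Matrix (Fin n) (Fin n) ℂ) - A)⁻¹ *
      (t • (1 : Matrix (Fin n) (Fin n) ℂ) - A)⁻¹) =
      (s • (1 : Matrix (Fin n) (Fin n) ℂ) - A)⁻¹ * ((s - t) • (1 : Matrix (Fin n) (Fin n) ℂ)) *
        (t • (1 : Matrix (Fin n) (Fin n) ℂ) - A)⁻¹ := by
    rw [Matrix.mul_smul, Matrix.mul_one, Matrix.smul_mul]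
  rw [h2, h1, Matrix.mul_sub, Matrix.sub_mul, Matrix.nonsing_inv_mul _ (isUnit_det_smul_one_sub hs),
    Matrix.mul_assoc, Matrix.mul_nonsing_inv _ (isUnit_det_smul_one_sub ht), Matrix.one_mul,
    Matrix.mul_one]

/-! ### Loewner matrices -/

section Loewner

variable {r p m n : ℕ} (u : Fin p → ℂ) (v : Fin m → ℂ) (σ τ : Fin r → ℂ)

/-- The Loewner matrix of `H` for the left points `σ`, the right points `τ` and the tangential
directions `u`, `v`. -/
noncomputable def loewner (H : ℂ → Matrix (Fin p) (Fin m) ℂ) : Matrix (Fin r) (Fin r) ℂ :=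
  Matrix.of fun k j => (u ⬝ᵥ (H (τ j) *ᵥ v) - u ⬝ᵥ (H (σ k) *ᵥ v)) / (σ k - τ j)

/-- The shifted Loewner matrix of `H`. -/
noncomputable def shiftedLoewner (H : ℂ → Matrix (Fin p) (Fin m) ℂ) :
    Matrix (Fin r) (Fin r) ℂ :=
  Matrix.of fun k j => τ j * loewner u v σ τ H k j - u ⬝ᵥ (H (σ k) *ᵥ v)

/-- The matrix with columns `H (τ j) v`. -/
def rightData (H : ℂ → Matrix (Fin p) (Fin m) ℂ) : Matrix (Fin p) (Fin r) ℂ :=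
  Matrix.of fun i j => (H (τ j) *ᵥ v) i

/-- The matrix with rows `u H (σ k)`. -/
def leftData (H : ℂ → Matrix (Fin p) (Fin m) ℂ) : Matrix (Fin r) (Fin m) ℂ :=
  Matrix.of fun k j => (u ᵥ* H (σ k)) j

/-- The matrix with rows `u C (σ k - A)⁻¹`. -/
noncomputable def observabilityMatrix (A : Matrix (Fin n) (Fin n) ℂ)
    (C : Matrix (Fin p) (Fin n) ℂ) : Matrix (Fin r) (Fin n) ℂ :=
  Matrix.of fun k => u ᵥ* (C * (σ k • (1 : Matrix (Fin n) (Fin n) ℂ) - A)⁻¹)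

/-- The matrix with columns `(τ j - A)⁻¹ B v`. -/
noncomputable def reachabilityMatrix (A : Matrix (Fin n) (Fin n) ℂ)
    (B : Matrix (Fin n) (Fin m) ℂ) : Matrix (Fin n) (Fin r) ℂ :=
  Matrix.of fun i j => (((τ j • (1 : Matrix (Fin n) (Fin n) ℂ) - A)⁻¹ * B) *ᵥ v) i

variable {u v σ τ} {A : Matrix (Fin n) (Fin n) ℂ} {B : Matrix (Fin n) (Fin m) ℂ}
  {C : Matrix (Fin p) (Fin n) ℂ} {H : ℂ → Matrix (Fin p) (Fin m) ℂ}

theorem observabilityMatrix_mul_mul_reachabilityMatrix_apply (X : Matrix (Fin n) (Fin n) ℂ)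
    (k j : Fin r) :
    (observabilityMatrix u σ A C * X * reachabilityMatrix v τ A B) k j =
      u ⬝ᵥ ((C * (σ k • (1 : Matrix (Fin n) (Fin n) ℂ) - A)⁻¹ * X *
        (τ j • (1 : Matrix (Fin n) (Fin n) ℂ) - A)⁻¹ * B) *ᵥ v) := by
  have h1 : (observabilityMatrix u σ A C * X * reachabilityMatrix v τ A B) k j =
      (u ᵥ* (C * (σ k • (1 : Matrix (Fin n) (Fin n) ℂ) - A)⁻¹) ᵥ* X) ⬝ᵥ
        (((τ j • (1 : Matrix (Fin n) (Fin n) ℂ) - A)⁻¹ * B) *ᵥ v) := rfl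
  rw [h1, Matrix.vecMul_vecMul, ← Matrix.dotProduct_mulVec, Matrix.mulVec_mulVec]
  simp only [Matrix.mul_assoc]

/-- By the resolvent identity, `u C (σ - A)⁻¹ (τ - A)⁻¹ B v` is a divided difference of the transfer
function. The right-hand side knows only values of `H`, while the left-hand side factors through the
state space of any realization, of any order `n`. -/
theorem observabilityMatrix_mul_reachabilityMatrix (hσ : ∀ k, σ k ∉ spectrum ℂ A)
    (hτ : ∀ j, τ j ∉ spectrum ℂ A) (hστ : ∀ k j, σ k ≠ τ j)
    (hHσ : ∀ k, H (σ k) = transferFunction A B C (σ k))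
    (hHτ : ∀ j, H (τ j) = transferFunction A B C (τ j)) :
    observabilityMatrix u σ A C * reachabilityMatrix v τ A B = loewner u v σ τ H := by
  ext k j
  have h := observabilityMatrix_mul_mul_reachabilityMatrix_apply (u := u) (v := v) (σ := σ)
    (τ := τ) (A := A) (B := B) (C := C) 1 k j
  rw [Matrix.mul_one] at h
  rw [h, loewner, Matrix.of_apply, eq_div_iff (sub_ne_zero.2 (hστ k j)), hHσ, hHτ,
    ← dotProduct_sub, ← Matrix.sub_mulVec, transferFunction, transferFunction, ← Matrix.sub_mul,
    ← Matrix.mul_sub, resolvent_sub_eq (hσ k) (hτ j), Matrix.mul_smul, Matrix.smul_mul,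
    Matrix.smul_mulVec, dotProduct_smul, smul_eq_mul, mul_comm, Matrix.mul_one]
  simp only [Matrix.mul_assoc]

/-- The extra factor is absorbed by `A (τ - A)⁻¹ = τ (τ - A)⁻¹ - 1`. -/
theorem observabilityMatrix_mul_mul_reachabilityMatrix (hσ : ∀ k, σ k ∉ spectrum ℂ A)
    (hτ : ∀ j, τ j ∉ spectrum ℂ A) (hστ : ∀ k j, σ k ≠ τ j)
    (hHσ : ∀ k, H (σ k) = transferFunction A B C (σ k))
    (hHτ : ∀ j, H (τ j) = transferFunction A B C (τ j)) :
    observabilityMatrix u σ A C * A * reachabilityMatrix v τ A B = shiftedLoewner u v σ τ H := by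
  ext k j
  have h1 : A * (τ j • (1 : Matrix (Fin n) (Fin n) ℂ) - A)⁻¹ =
      τ j • (τ j • (1 : Matrix (Fin n) (Fin n) ℂ) - A)⁻¹ - 1 := by
    have h := Matrix.mul_nonsing_inv _ (isUnit_det_smul_one_sub (hτ j))
    rw [Matrix.sub_mul, Matrix.smul_mul, Matrix.one_mul] at h
    exact eq_sub_of_add_eq (eq_add_of_sub_eq' h).symm
  rw [observabilityMatrix_mul_mul_reachabilityMatrix_apply, shiftedLoewner, Matrix.of_apply,
    ← observabilityMatrix_mul_reachabilityMatrix hσ hτ hστ hHσ hHτ, hHσ, transferFunction]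
  have h := observabilityMatrix_mul_mul_reachabilityMatrix_apply (u := u) (v := v) (σ := σ)
    (τ := τ) (A := A) (B := B) (C := C) 1 k j
  rw [Matrix.mul_one, Matrix.mul_one] at h
  rw [h, Matrix.mul_assoc (C * _) A, h1, Matrix.mul_sub, Matrix.sub_mul, Matrix.sub_mulVec,
    dotProduct_sub, Matrix.mul_one, Matrix.mul_smul, Matrix.smul_mul, Matrix.smul_mulVec,
    dotProduct_smul, smul_eq_mul]

theorem mul_reachabilityMatrix (hHτ : ∀ j, H (τ j) = transferFunction A B C (τ j)) :
    C * reachabilityMatrix v τ A B = rightData v τ H := by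
  ext i j
  have h1 : (C * reachabilityMatrix v τ A B) i j =
      (C *ᵥ (((τ j • (1 : Matrix (Fin n) (Fin n) ℂ) - A)⁻¹ * B) *ᵥ v)) i := rfl
  rw [h1, rightData, Matrix.of_apply, hHτ, transferFunction, Matrix.mulVec_mulVec,
    Matrix.mul_assoc]

theorem observabilityMatrix_mul (hHσ : ∀ k, H (σ k) = transferFunction A B C (σ k)) :
    observabilityMatrix u σ A C * B = leftData u σ H := by
  ext k j
  have h1 : (observabilityMatrix u σ A C * B) k j =
      (u ᵥ* (C * (σ k • (1 : Matrix (Fin n) (Fin n) ℂ) - A)⁻¹) ᵥ* B) j := rfl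
  rw [h1, leftData, Matrix.of_apply, hHσ, transferFunction, Matrix.vecMul_vecMul]

theorem observabilityMatrix_mul_pencil_mul (hσ : ∀ k, σ k ∉ spectrum ℂ A)
    (hτ : ∀ j, τ j ∉ spectrum ℂ A) (hστ : ∀ k j, σ k ≠ τ j)
    (hHσ : ∀ k, H (σ k) = transferFunction A B C (σ k))
    (hHτ : ∀ j, H (τ j) = transferFunction A B C (τ j)) (s : ℂ) :
    observabilityMatrix u σ A C * (s • (1 : Matrix (Fin n) (Fin n) ℂ) - A) *
        reachabilityMatrix v τ A B =
      s • loewner u v σ τ H - shiftedLoewner u v σ τ H := by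
  rw [← observabilityMatrix_mul_mul_reachabilityMatrix hσ hτ hστ hHσ hHτ,
    ← observabilityMatrix_mul_reachabilityMatrix hσ hτ hστ hHσ hHτ, Matrix.mul_sub, Matrix.sub_mul,
    Matrix.mul_smul, Matrix.mul_one, Matrix.smul_mul]

end Loewner

/-- A function with a realization of order `r` is recovered from its Loewner data, if the Loewner
matrix of size `r` is invertible. -/
theorem transferFunction_eq_loewner {r p m : ℕ} {u : Fin p → ℂ} {v : Fin m → ℂ} {σ τ : Fin r → ℂ}
    {A : Matrix (Fin r) (Fin r) ℂ} {B : Matrix (Fin r) (Fin m) ℂ} {C : Matrix (Fin p) (Fin r) ℂ}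
    {H : ℂ → Matrix (Fin p) (Fin m) ℂ} (hσ : ∀ k, σ k ∉ spectrum ℂ A)
    (hτ : ∀ j, τ j ∉ spectrum ℂ A) (hστ : ∀ k j, σ k ≠ τ j)
    (hHσ : ∀ k, H (σ k) = transferFunction A B C (σ k))
    (hHτ : ∀ j, H (τ j) = transferFunction A B C (τ j))
    (hdet : (loewner u v σ τ H).det ≠ 0) (s : ℂ) :
    transferFunction A B C s = rightData v τ H *
      (s • loewner u v σ τ H - shiftedLoewner u v σ τ H)⁻¹ * leftData u σ H := by
  have hOR := observabilityMatrix_mul_reachabilityMatrix (u := u) (v := v) hσ hτ hστ hHσ hHτ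
  -- The factors are square because the order equals `r`, so both are invertible and cancel in `C R
  -- (O (s - A) R)⁻¹ O B`. The product rule for `⁻¹` holds for singular matrices too, so `s` may be
  -- arbitrary.
  rw [← hOR, Matrix.det_mul, mul_ne_zero_iff] at hdet
  rw [← observabilityMatrix_mul_pencil_mul hσ hτ hστ hHσ hHτ s, ← mul_reachabilityMatrix hHτ,
    ← observabilityMatrix_mul hHσ, Matrix.mul_inv_rev, Matrix.mul_inv_rev, transferFunction]
  have h1 := Matrix.mul_nonsing_inv _ (isUnit_iff_ne_zero.2 hdet.2)
  have h2 := Matrix.nonsing_inv_mul _ (isUnit_iff_ne_zero.2 hdet.1)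
  generalize reachabilityMatrix v τ A B = R at *
  generalize observabilityMatrix u σ A C = O at *
  calc C * (s • (1 : Matrix (Fin r) (Fin r) ℂ) - A)⁻¹ * B
      = C * (R * R⁻¹) * (s • (1 : Matrix (Fin r) (Fin r) ℂ) - A)⁻¹ * (O⁻¹ * O) * B := by
        rw [h1, h2, Matrix.mul_one, Matrix.mul_one]
    _ = _ := by simp only [Matrix.mul_assoc]

/-! ### Pole-residue form -/

/-- Weighted Cauchy matrices are nonsingular. -/
theorem det_cauchy_ne_zero {r : ℕ} {σ lam w : Fin r → ℂ} (hσ : Function.Injective σ)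
    (hlam : Function.Injective lam) (hne : ∀ k i, σ k ≠ lam i) (hw : ∀ i, w i ≠ 0) :
    (Matrix.of fun k i => w i * (σ k - lam i)⁻¹).det ≠ 0 := by
  intro hdet
  obtain ⟨a, ha0, ha⟩ := Matrix.exists_mulVec_eq_zero_iff.2 hdet
  -- `P` is the numerator of `∑ wᵢ aᵢ / (s - λᵢ)`. It has degree less than `r` and vanishes at the
  -- `r` points `σ k`, so it is zero; its value at `λᵢ` is a nonzero multiple of `aᵢ`.
  set P : Polynomial ℂ := ∑ i, Polynomial.C (w i * a i) *
    ∏ j ∈ Finset.univ.erase i, (Polynomial.X - Polynomial.C (lam j)) with hP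
  have hcard : ∀ i : Fin r, (Finset.univ.erase i).card < r := by
    intro i
    have := i.pos
    rw [Finset.card_erase_of_mem (Finset.mem_univ i), Finset.card_univ, Fintype.card_fin]
    omega
  have hdeg : P.degree < (Finset.univ : Finset (Fin r)).card := by
    rw [Finset.card_univ, Fintype.card_fin, hP]
    refine (Polynomial.degree_sum_le _ _).trans_lt ((Finset.sup_lt_iff (WithBot.bot_lt_coe _)).2
      fun i _ => ?_)
    refine lt_of_le_of_lt (b := (∏ j ∈ Finset.univ.erase i,
      (Polynomial.X - Polynomial.C (lam j))).degree) ?_ ?_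
    · rw [← Polynomial.smul_eq_C_mul]
      exact Polynomial.degree_smul_le _ _
    rw [Polynomial.degree_prod]
    simp only [Polynomial.degree_X_sub_C, Finset.sum_const, nsmul_eq_mul, mul_one]
    exact_mod_cast hcard i
  have heval : ∀ k, P.eval (σ k) = 0 := by
    intro k
    have h1 := congrFun ha k
    simp only [Matrix.mulVec, dotProduct, Matrix.of_apply, Pi.zero_apply] at h1
    rw [hP, Polynomial.eval_finsetSum]
    simp only [Polynomial.eval_mul, Polynomial.eval_C, Polynomial.eval_prod, Polynomial.eval_sub,
      Polynomial.eval_X]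
    rw [← mul_zero (∏ j, (σ k - lam j)), ← h1, Finset.mul_sum]
    refine Finset.sum_congr rfl fun i _ => ?_
    rw [← Finset.mul_prod_erase Finset.univ (fun j => σ k - lam j) (Finset.mem_univ i)]
    have := sub_ne_zero.2 (hne k i)
    field_simp
  have hP0 : P = 0 := Polynomial.eq_zero_of_degree_lt_of_eval_index_eq_zero _ hσ.injOn hdeg
    fun k _ => heval k
  apply ha0
  funext i
  have h1 : P.eval (lam i) = 0 := by rw [hP0, Polynomial.eval_zero]
  rw [hP, Polynomial.eval_finsetSum, Finset.sum_eq_single i] at h1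
  · simp only [Polynomial.eval_mul, Polynomial.eval_C, Polynomial.eval_prod, Polynomial.eval_sub,
      Polynomial.eval_X, mul_eq_zero, hw i, false_or, Finset.prod_eq_zero_iff, sub_eq_zero] at h1
    rcases h1 with h1 | ⟨j, hj, hij⟩
    · exact h1
    · exact absurd (hlam hij).symm (Finset.ne_of_mem_erase hj)
  · intro j _ hji
    simp only [Polynomial.eval_mul, Polynomial.eval_prod, Polynomial.eval_sub, Polynomial.eval_X,
      Polynomial.eval_C]
    rw [Finset.prod_eq_zero (Finset.mem_erase.2 ⟨hji.symm, Finset.mem_univ i⟩) (sub_self _),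
      mul_zero]
  · simp

/-- Finitely many hyperplanes do not cover the dual space. A single direction `u` thus sees every
residue, which reduces the matrix-valued problem to scalar Loewner matrices. -/
theorem exists_dotProduct_ne_zero {r p : ℕ} {c : Fin r → Fin p → ℂ} (hc : ∀ i, c i ≠ 0) :
    ∃ u : Fin p → ℂ, ∀ i, u ⬝ᵥ c i ≠ 0 := by
  obtain ⟨f, hf⟩ := Module.exists_dual_forall_apply_ne_zero (K := ℂ) c hc
  refine ⟨fun k => f (Pi.single k 1), fun i => ?_⟩
  convert hf i using 1
  conv_rhs => rw [LinearMap.pi_apply_eq_sum_univ f (c i)]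
  simp only [dotProduct, smul_eq_mul]
  refine Finset.sum_congr rfl fun k _ => ?_
  rw [mul_comm]
  congr 2
  funext j
  simp [Pi.single_apply, eq_comm]

theorem infinite_rightHalfPlane_sdiff {S : Set ℂ} (hS : S.Finite) :
    ({s : ℂ | 0 < s.re} \ S).Infinite := by
  refine Infinite.sdiff ?_ hS
  refine (infinite_of_injective_forall_mem (f := fun k : ℕ => ((k : ℂ) + 1)) ?_ fun k => ?_)
  · intro a b hab
    simpa using hab
  · simp only [mem_ofPred_eq, Complex.add_re, Complex.natCast_re, Complex.one_re]
    positivity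

theorem exists_interpolation_points (r : ℕ) {S : Set ℂ} (hS : S.Finite) :
    ∃ σ τ : Fin r → ℂ, Function.Injective σ ∧ Function.Injective τ ∧ (∀ k j, σ k ≠ τ j) ∧
      (∀ k, 0 < (σ k).re ∧ σ k ∉ S) ∧ ∀ j, 0 < (τ j).re ∧ τ j ∉ S := by
  let e := (infinite_rightHalfPlane_sdiff hS).natEmbedding
  have he : ∀ a b, (e a : ℂ) = e b → a = b := fun a b h => e.injective (Subtype.ext h)
  refine ⟨fun k => e k, fun j => e (r + j), fun a b h => Fin.ext (he _ _ h), fun a b h => ?_,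
    fun k j h => ?_, fun k => (e k).2, fun j => (e _).2⟩
  · have := he _ _ h
    exact Fin.ext (by omega)
  · have := he _ _ h
    have := k.2
    omega

section PoleResidue

variable {r p m : ℕ} {lam : Fin r → ℂ} {b : Fin r → Fin m → ℂ} {c : Fin r → Fin p → ℂ}

theorem inv_smul_one_sub_diagonal {s : ℂ} (hs : ∀ i, s ≠ lam i) :
    (s • (1 : Matrix (Fin r) (Fin r) ℂ) - Matrix.diagonal lam)⁻¹ =
      Matrix.diagonal fun i => (s - lam i)⁻¹ := by
  have h1 : s • (1 : Matrix (Fin r) (Fin r) ℂ) - Matrix.diagonal lam =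
      Matrix.diagonal fun i => s - lam i := by
    rw [Matrix.smul_one_eq_diagonal, Matrix.diagonal_sub]
  rw [h1]
  refine Matrix.inv_eq_right_inv ?_
  rw [Matrix.diagonal_mul_diagonal, ← Matrix.diagonal_one]
  congr 1
  funext i
  exact mul_inv_cancel₀ (sub_ne_zero.2 (hs i))

theorem mul_diagonal_mul_eq_sum (X : Matrix (Fin p) (Fin r) ℂ) (Y : Matrix (Fin r) (Fin m) ℂ)
    (d : Fin r → ℂ) :
    X * Matrix.diagonal d * Y = ∑ i, d i • Matrix.vecMulVec (fun k => X k i) (Y i) := by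
  ext k j
  rw [Matrix.mul_apply, Matrix.sum_apply]
  refine Finset.sum_congr rfl fun i _ => ?_
  rw [Matrix.mul_diagonal, Matrix.smul_apply, Matrix.vecMulVec_apply, smul_eq_mul]
  ring

/-- The diagonal realization of a function in pole-residue form. -/
theorem transferFunction_diagonal {s : ℂ} (hs : ∀ i, s ≠ lam i) :
    transferFunction (Matrix.diagonal lam) (Matrix.of fun i => star (b i)) (Matrix.of c)ᵀ s =
      ∑ i, (s - lam i)⁻¹ • Matrix.vecMulVec (c i) (star (b i)) := by
  rw [transferFunction, inv_smul_one_sub_diagonal hs, mul_diagonal_mul_eq_sum]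
  rfl

theorem det_observabilityMatrix_diagonal_ne_zero {u : Fin p → ℂ} {σ : Fin r → ℂ}
    (hσ : Function.Injective σ) (hlam : Function.Injective lam) (hne : ∀ k i, σ k ≠ lam i)
    (hu : ∀ i, u ⬝ᵥ c i ≠ 0) :
    (observabilityMatrix u σ (Matrix.diagonal lam) (Matrix.of c)ᵀ).det ≠ 0 := by
  convert det_cauchy_ne_zero hσ hlam hne hu using 2
  ext k i
  rw [observabilityMatrix, Matrix.of_apply, inv_smul_one_sub_diagonal (hne k),
    ← Matrix.vecMul_vecMul, Matrix.vecMul_diagonal]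
  rfl

theorem det_reachabilityMatrix_diagonal_ne_zero {v : Fin m → ℂ} {τ : Fin r → ℂ}
    (hτ : Function.Injective τ) (hlam : Function.Injective lam) (hne : ∀ j i, τ j ≠ lam i)
    (hv : ∀ i, v ⬝ᵥ star (b i) ≠ 0) :
    (reachabilityMatrix v τ (Matrix.diagonal lam) (Matrix.of fun i => star (b i))).det ≠ 0 := by
  rw [← Matrix.det_transpose]
  convert det_cauchy_ne_zero hτ hlam hne hv using 2
  ext j i
  rw [Matrix.transpose_apply, reachabilityMatrix, Matrix.of_apply,
    inv_smul_one_sub_diagonal (hne j), ← Matrix.mulVec_mulVec, Matrix.mulVec_diagonal,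
    Matrix.of_apply, mul_comm, dotProduct_comm v]
  rfl

theorem notMem_spectrum_diagonal_iff {s : ℂ} :
    s ∉ spectrum ℂ (Matrix.diagonal lam) ↔ ∀ i, s ≠ lam i := by
  rw [spectrum_diagonal]
  simp [eq_comm]

theorem det_loewner_ne_zero {u : Fin p → ℂ} {v : Fin m → ℂ} {σ τ : Fin r → ℂ}
    {H : ℂ → Matrix (Fin p) (Fin m) ℂ} (hlam : Function.Injective lam)
    (hσ : Function.Injective σ) (hτ : Function.Injective τ) (hσl : ∀ k i, σ k ≠ lam i)
    (hτl : ∀ j i, τ j ≠ lam i) (hστ : ∀ k j, σ k ≠ τ j) (hu : ∀ i, u ⬝ᵥ c i ≠ 0)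
    (hv : ∀ i, v ⬝ᵥ star (b i) ≠ 0)
    (hHσ : ∀ k, H (σ k) = ∑ i, (σ k - lam i)⁻¹ • Matrix.vecMulVec (c i) (star (b i)))
    (hHτ : ∀ j, H (τ j) = ∑ i, (τ j - lam i)⁻¹ • Matrix.vecMulVec (c i) (star (b i))) :
    (loewner u v σ τ H).det ≠ 0 := by
  rw [← observabilityMatrix_mul_reachabilityMatrix (A := Matrix.diagonal lam)
    (B := Matrix.of fun i => star (b i)) (C := (Matrix.of c)ᵀ)
    (fun k => notMem_spectrum_diagonal_iff.2 (hσl k))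
    (fun j => notMem_spectrum_diagonal_iff.2 (hτl j)) hστ
    (fun k => by rw [transferFunction_diagonal (hσl k), hHσ])
    (fun j => by rw [transferFunction_diagonal (hτl j), hHτ]), Matrix.det_mul]
  exact mul_ne_zero (det_observabilityMatrix_diagonal_ne_zero hσ hlam hσl hu)
    (det_reachabilityMatrix_diagonal_ne_zero hτ hlam hτl hv)

/-- The nonsingular `r × r` Loewner matrix factors through `ℂᵏ` for each realization of order `k`,
so its rank `r` is at most `k`. -/
theorem isMinimalRealization_diagonal (hlam : Function.Injective lam) (hb : ∀ i, b i ≠ 0)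
    (hc : ∀ i, c i ≠ 0) :
    IsMinimalRealization (Matrix.diagonal lam) (Matrix.of fun i => star (b i)) (Matrix.of c)ᵀ := by
  intro k A' B' C' h
  obtain ⟨u, hu⟩ := exists_dotProduct_ne_zero hc
  obtain ⟨v, hv⟩ := exists_dotProduct_ne_zero (c := fun i => star (b i))
    fun i => star_ne_zero.2 (hb i)
  obtain ⟨σ, τ, hσ, hτ, hστ, hσS, hτS⟩ := exists_interpolation_points r
    ((Matrix.finite_spectrum (Matrix.diagonal lam)).union (Matrix.finite_spectrum A'))
  have hσ1 : ∀ k, σ k ∉ spectrum ℂ (Matrix.diagonal lam) := fun k hk => (hσS k).2 (Or.inl hk)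
  have hτ1 : ∀ k, τ k ∉ spectrum ℂ (Matrix.diagonal lam) := fun k hk => (hτS k).2 (Or.inl hk)
  have hσ2 : ∀ k, σ k ∉ spectrum ℂ A' := fun k hk => (hσS k).2 (Or.inr hk)
  have hτ2 : ∀ k, τ k ∉ spectrum ℂ A' := fun k hk => (hτS k).2 (Or.inr hk)
  have hσl := fun k => notMem_spectrum_diagonal_iff.1 (hσ1 k)
  have hτl := fun k => notMem_spectrum_diagonal_iff.1 (hτ1 k)
  have hdet := det_loewner_ne_zero (u := u) (v := v) (b := b) (c := c)
    (H := transferFunction (Matrix.diagonal lam) (Matrix.of fun i => star (b i)) (Matrix.of c)ᵀ)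
    hlam hσ hτ hσl hτl hστ hu hv
    (fun k => transferFunction_diagonal (hσl k)) (fun j => transferFunction_diagonal (hτl j))
  rw [← observabilityMatrix_mul_reachabilityMatrix (u := u) (v := v) hσ2 hτ2 hστ
    (fun k => (h _ (hσ1 k) (hσ2 k)).symm) (fun j => (h _ (hτ1 j) (hτ2 j)).symm)] at hdet
  have h1 := Matrix.rank_of_isUnit _
    ((Matrix.isUnit_iff_isUnit_det _).2 (isUnit_iff_ne_zero.2 hdet))
  rw [Fintype.card_fin] at h1
  rw [← h1]
  exact (Matrix.rank_mul_le_left _ _).trans (Matrix.rank_le_width _)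

/-- The poles of a function in pole-residue form with nonzero residue vectors are eigenvalues of
the state matrix of each realization of the same order. -/
theorem mem_spectrum_of_transferFunction_eq (hlam : Function.Injective lam) (hb : ∀ i, b i ≠ 0)
    (hc : ∀ i, c i ≠ 0) {A : Matrix (Fin r) (Fin r) ℂ} {B : Matrix (Fin r) (Fin m) ℂ}
    {C : Matrix (Fin p) (Fin r) ℂ}
    (h : ∀ s : ℂ, 0 < s.re → transferFunction A B C s =
      ∑ i, (s - lam i)⁻¹ • Matrix.vecMulVec (c i) (star (b i))) (i : Fin r) :
    lam i ∈ spectrum ℂ A := by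
  by_contra hmem
  obtain ⟨u, hu⟩ := exists_dotProduct_ne_zero hc
  obtain ⟨v, hv⟩ := exists_dotProduct_ne_zero (c := fun i => star (b i))
    fun i => star_ne_zero.2 (hb i)
  obtain ⟨σ, τ, hσ, hτ, hστ, hσS, hτS⟩ := exists_interpolation_points r
    ((Matrix.finite_spectrum (Matrix.diagonal lam)).union (Matrix.finite_spectrum A))
  have hσ1 : ∀ k, σ k ∉ spectrum ℂ (Matrix.diagonal lam) := fun k hk => (hσS k).2 (Or.inl hk)
  have hτ1 : ∀ k, τ k ∉ spectrum ℂ (Matrix.diagonal lam) := fun k hk => (hτS k).2 (Or.inl hk)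
  have hσ2 : ∀ k, σ k ∉ spectrum ℂ A := fun k hk => (hσS k).2 (Or.inr hk)
  have hτ2 : ∀ k, τ k ∉ spectrum ℂ A := fun k hk => (hτS k).2 (Or.inr hk)
  have hσl := fun k => notMem_spectrum_diagonal_iff.1 (hσ1 k)
  have hτl := fun k => notMem_spectrum_diagonal_iff.1 (hτ1 k)
  have hdet := det_loewner_ne_zero (u := u) (v := v) hlam hσ hτ hσl hτl hστ hu hv
    (fun k => h _ (hσS k).1) (fun j => h _ (hτS j).1)
  -- The Loewner pencil at `λᵢ` is factored through both realizations: it is singular by the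
  -- diagonal one, and would be nonsingular by the other if `λᵢ` were not an eigenvalue of `A`.
  have h1 := observabilityMatrix_mul_pencil_mul (u := u) (v := v) (H := transferFunction A B C)
    hσ2 hτ2 hστ (fun _ => rfl) (fun _ => rfl) (lam i)
  have h2 := observabilityMatrix_mul_pencil_mul (u := u) (v := v) (H := transferFunction A B C)
    (A := Matrix.diagonal lam) (B := Matrix.of fun i => star (b i)) (C := (Matrix.of c)ᵀ)
    hσ1 hτ1 hστ (fun k => by rw [transferFunction_diagonal (hσl k), h _ (hσS k).1])
    (fun j => by rw [transferFunction_diagonal (hτl j), h _ (hτS j).1]) (lam i)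
  have h3 := congrArg Matrix.det (h1.trans h2.symm)
  have h4 : (lam i • (1 : Matrix (Fin r) (Fin r) ℂ) - Matrix.diagonal lam).det = 0 := by
    rw [Matrix.smul_one_eq_diagonal, Matrix.diagonal_sub, Matrix.det_diagonal]
    exact Finset.prod_eq_zero (Finset.mem_univ i) (sub_self _)
  rw [← observabilityMatrix_mul_reachabilityMatrix (u := u) (v := v) hσ2 hτ2 hστ
    (fun _ => rfl) (fun _ => rfl), Matrix.det_mul, mul_ne_zero_iff] at hdet
  rw [Matrix.det_mul, Matrix.det_mul, Matrix.det_mul, Matrix.det_mul, h4, mul_zero, zero_mul] at h3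
  exact mul_ne_zero (mul_ne_zero hdet.1 (isUnit_det_smul_one_sub hmem).ne_zero) hdet.2 h3

end PoleResidue

/-! ### Identity theorem for transfer functions -/

/-- Cramer's rule: `C adj(s - A) B` is a polynomial numerator over the characteristic polynomial. -/
theorem exists_polynomial_transferFunction {n p m : ℕ} (A : Matrix (Fin n) (Fin n) ℂ)
    (B : Matrix (Fin n) (Fin m) ℂ) (C : Matrix (Fin p) (Fin n) ℂ) :
    ∃ N : Matrix (Fin p) (Fin m) (Polynomial ℂ), ∀ s, s ∉ spectrum ℂ A → ∀ i j,
      A.charpoly.eval s ≠ 0 ∧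
        A.charpoly.eval s * transferFunction A B C s i j = (N i j).eval s := by
  refine ⟨C.map Polynomial.C * A.charmatrix.adjugate * B.map Polynomial.C, fun s hs i j => ?_⟩
  have hmap : (Polynomial.evalRingHom s).mapMatrix A.charmatrix =
      s • (1 : Matrix (Fin n) (Fin n) ℂ) - A := by
    ext a b
    rw [RingHom.mapMatrix_apply, Matrix.map_apply, Matrix.charmatrix_apply]
    by_cases hab : a = b
    · subst hab; simp
    · simp [hab]
  have hdet : A.charpoly.eval s = (s • (1 : Matrix (Fin n) (Fin n) ℂ) - A).det := by
    rw [← hmap, ← RingHom.map_det]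
    rfl
  have hunit := isUnit_det_smul_one_sub hs
  refine ⟨hdet ▸ hunit.ne_zero, ?_⟩
  have hN : (Polynomial.evalRingHom s) ((C.map Polynomial.C * A.charmatrix.adjugate *
      B.map Polynomial.C) i j) =
      (C * (s • (1 : Matrix (Fin n) (Fin n) ℂ) - A).adjugate * B) i j := by
    rw [← hmap, ← RingHom.map_adjugate]
    simp [Matrix.mul_apply, Polynomial.eval_finsetSum]
  rw [← Polynomial.coe_evalRingHom, hN, Polynomial.coe_evalRingHom, hdet, transferFunction,
    Matrix.inv_def, Matrix.mul_smul, Matrix.smul_mul, Matrix.smul_apply, smul_eq_mul,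
    ← mul_assoc, Ring.mul_inverse_cancel _ hunit, one_mul]

/-- After cross-multiplication both sides are polynomials that agree at infinitely many points. This
carries equality from the half-plane to all points off both spectra, as minimality requires. -/
theorem transferFunction_eq_of_eqOn_infinite {n n' p m : ℕ} {A : Matrix (Fin n) (Fin n) ℂ}
    {B : Matrix (Fin n) (Fin m) ℂ} {C : Matrix (Fin p) (Fin n) ℂ}
    {A' : Matrix (Fin n') (Fin n') ℂ} {B' : Matrix (Fin n') (Fin m) ℂ}
    {C' : Matrix (Fin p) (Fin n') ℂ} {T : Set ℂ} (hT : T.Infinite)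
    (hTA : ∀ s ∈ T, s ∉ spectrum ℂ A) (hTA' : ∀ s ∈ T, s ∉ spectrum ℂ A')
    (h : ∀ s ∈ T, transferFunction A' B' C' s = transferFunction A B C s) {s : ℂ}
    (hs : s ∉ spectrum ℂ A) (hs' : s ∉ spectrum ℂ A') :
    transferFunction A' B' C' s = transferFunction A B C s := by
  obtain ⟨N, hN⟩ := exists_polynomial_transferFunction A B C
  obtain ⟨N', hN'⟩ := exists_polynomial_transferFunction A' B' C'
  ext i j
  have hpoly : A.charpoly * N' i j = A'.charpoly * N i j := by
    refine Polynomial.eq_of_infinite_eval_eq _ _ (hT.mono fun t ht => ?_)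
    rw [mem_ofPred_eq, Polynomial.eval_mul, Polynomial.eval_mul, ← (hN t (hTA t ht) i j).2,
      ← (hN' t (hTA' t ht) i j).2, h t ht]
    ring
  have h1 := congrArg (Polynomial.eval s) hpoly
  rw [Polynomial.eval_mul, Polynomial.eval_mul, ← (hN s hs i j).2, ← (hN' s hs' i j).2] at h1
  refine mul_left_cancel₀ (mul_ne_zero (hN s hs i j).1 (hN' s hs' i j).1) ?_
  linear_combination h1

/-- In a pole-residue form with as many terms as the order of a minimal realization, all residues
are nonzero. -/
theorem vecMulVec_ne_zero_of_isMinimalRealization {r p m : ℕ} {lam : Fin r → ℂ}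
    {b : Fin r → Fin m → ℂ} {c : Fin r → Fin p → ℂ} {A : Matrix (Fin r) (Fin r) ℂ}
    {B : Matrix (Fin r) (Fin m) ℂ} {C : Matrix (Fin p) (Fin r) ℂ}
    (hmin : IsMinimalRealization A B C)
    (h : ∀ s : ℂ, 0 < s.re → transferFunction A B C s =
      ∑ i, (s - lam i)⁻¹ • Matrix.vecMulVec (c i) (star (b i))) (i : Fin r) :
    Matrix.vecMulVec (c i) (star (b i)) ≠ 0 := by
  intro h0
  obtain _ | n := r
  · exact i.elim0
  -- If the `i`-th residue is zero, dropping that term leaves a diagonal realization of order `n`,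
  -- one less than the minimal order.
  have hle := hmin n (Matrix.diagonal fun k => lam (i.succAbove k))
    (Matrix.of fun k => star (b (i.succAbove k))) (Matrix.of fun k => c (i.succAbove k))ᵀ
    fun s hs hs' => transferFunction_eq_of_eqOn_infinite
      (infinite_rightHalfPlane_sdiff ((Matrix.finite_spectrum A).union
        (Matrix.finite_spectrum (Matrix.diagonal fun k => lam (i.succAbove k)))))
      (fun t ht hmem => ht.2 (Or.inl hmem)) (fun t ht hmem => ht.2 (Or.inr hmem))
      (fun t ht => by
        rw [transferFunction_diagonal
          (notMem_spectrum_diagonal_iff.1 fun hmem => ht.2 (Or.inr hmem)), h t ht.1,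
          Fin.sum_univ_succAbove _ i, h0, smul_zero, zero_add]) hs hs'
  omega

/-! ### Entrywise derivatives of matrix-valued functions -/

section MatrixDerivatives

variable {α β γ : Type*}

theorem hasDerivAt_matrix_mul [Fintype β] {X : ℝ → Matrix α β ℂ} {Y : ℝ → Matrix β γ ℂ} {X' : Matrix α β ℂ}
    {Y' : Matrix β γ ℂ} {t₀ : ℝ} (hX : ∀ i j, HasDerivAt (fun t => X t i j) (X' i j) t₀)
    (hY : ∀ i j, HasDerivAt (fun t => Y t i j) (Y' i j) t₀) (i : α) (j : γ) :
    HasDerivAt (fun t => (X t * Y t) i j) ((X' * Y t₀ + X t₀ * Y') i j) t₀ := by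
  simp only [Matrix.add_apply, Matrix.mul_apply, ← Finset.sum_add_distrib]
  exact HasDerivAt.fun_sum fun k _ => (hX i k).fun_mul (hY k j)

variable [Fintype α] [DecidableEq α]

theorem differentiableAt_matrix_det {D : ℝ → Matrix α α ℂ} {t₀ : ℝ}
    (hD : ∀ i j, DifferentiableAt ℝ (fun t => D t i j) t₀) :
    DifferentiableAt ℝ (fun t => (D t).det) t₀ := by
  simp only [Matrix.det_apply']
  exact DifferentiableAt.fun_sum fun σ _ =>
    (DifferentiableAt.fun_finsetProd fun i _ => hD _ _).const_mul _

theorem differentiableAt_matrix_inv {D : ℝ → Matrix α α ℂ} {t₀ : ℝ}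
    (hD : ∀ i j, DifferentiableAt ℝ (fun t => D t i j) t₀) (hdet : (D t₀).det ≠ 0) (i j : α) :
    DifferentiableAt ℝ (fun t => (D t)⁻¹ i j) t₀ := by
  simp only [Matrix.inv_def, Matrix.smul_apply, smul_eq_mul, Ring.inverse_eq_inv',
    Matrix.adjugate_apply]
  refine ((differentiableAt_matrix_det hD).fun_inv hdet).fun_mul
    (differentiableAt_matrix_det fun k l => ?_)
  by_cases hk : k = j
  · subst hk
    simp only [Matrix.updateRow_self]
    exact differentiableAt_const _
  · simp only [Matrix.updateRow_ne hk]
    exact hD k l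

/-- Differentiability comes from Cramer's rule; the value of the derivative comes from
differentiating `D D⁻¹ = 1`, which holds near `t₀` because the determinant is continuous there. -/
theorem hasDerivAt_matrix_inv {D : ℝ → Matrix α α ℂ} {D' : Matrix α α ℂ} {t₀ : ℝ}
    (hD : ∀ i j, HasDerivAt (fun t => D t i j) (D' i j) t₀) (hdet : (D t₀).det ≠ 0) (i j : α) :
    HasDerivAt (fun t => (D t)⁻¹ i j) ((-((D t₀)⁻¹ * D' * (D t₀)⁻¹)) i j) t₀ := by
  have hdiff := differentiableAt_matrix_inv (fun i j => (hD i j).differentiableAt) hdet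
  set E' : Matrix α α ℂ := Matrix.of fun i j => deriv (fun t => (D t)⁻¹ i j) t₀ with hE'
  have hE : ∀ i j, HasDerivAt (fun t => (D t)⁻¹ i j) (E' i j) t₀ := fun i j =>
    (hdiff i j).hasDerivAt
  have hev : ∀ᶠ t in 𝓝 t₀, (D t).det ≠ 0 :=
    (differentiableAt_matrix_det fun i j => (hD i j).differentiableAt).continuousAt.eventually_ne
      hdet
  have hzero : D' * (D t₀)⁻¹ + D t₀ * E' = 0 := by
    ext k l
    refine (hasDerivAt_matrix_mul hD hE k l).unique
      ((hasDerivAt_const t₀ ((1 : Matrix α α ℂ) k l)).congr_of_eventuallyEq ?_)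
    filter_upwards [hev] with t ht
    rw [Matrix.mul_nonsing_inv _ (isUnit_iff_ne_zero.2 ht)]
  have hE'eq : E' = -((D t₀)⁻¹ * D' * (D t₀)⁻¹) := by
    have h1 : (D t₀)⁻¹ * (D t₀ * E') = E' := by
      rw [← Matrix.mul_assoc, Matrix.nonsing_inv_mul _ (isUnit_iff_ne_zero.2 hdet), Matrix.one_mul]
    rw [← h1, eq_neg_of_add_eq_zero_right hzero, Matrix.mul_neg, Matrix.mul_assoc]
  exact hE'eq ▸ hE i j

end MatrixDerivatives

/-! ### The tangent space -/

section TangentSpace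

variable {r p m : ℕ} {lam : Fin r → ℂ} {b : Fin r → Fin m → ℂ} {c : Fin r → Fin p → ℂ}

theorem IsHurwitz.notMem_spectrum {A : Matrix (Fin r) (Fin r) ℂ} (hA : IsHurwitz A) {s : ℂ}
    (hs : 0 < s.re) : s ∉ spectrum ℂ A := fun h => lt_asymm hs (hA s h)

/-- A function in pole-residue form with distinct stable poles and nonzero residue vectors has
McMillan degree equal to the number of poles. -/
theorem mem_stableRational_of_poleResidue {H : HardyTwo p m} (hlam : Function.Injective lam)
    (hre : ∀ i, (lam i).re < 0) (hb : ∀ i, b i ≠ 0) (hc : ∀ i, c i ≠ 0)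
    (hH : ∀ s : ℂ, 0 < s.re →
      H s = ∑ i, (s - lam i)⁻¹ • Matrix.vecMulVec (c i) (star (b i))) :
    H ∈ stableRational r m p := by
  refine ⟨Matrix.diagonal lam, Matrix.of fun i => star (b i), (Matrix.of c)ᵀ, ?_,
    isMinimalRealization_diagonal hlam hb hc, fun s hs => ?_⟩
  · intro z hz
    rw [spectrum_diagonal] at hz
    obtain ⟨i, rfl⟩ := hz
    exact hre i
  · rw [hH s hs, transferFunction_diagonal]
    rintro i rfl
    exact lt_asymm hs (hre i)

/-- Minimality makes the residues nonzero; nonzero residues make each `λᵢ` an eigenvalue of a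
Hurwitz state matrix. -/
theorem poleResidue_of_mem_stableRational {H : HardyTwo p m} (hmem : H ∈ stableRational r m p)
    (hlam : Function.Injective lam)
    (hH : ∀ s : ℂ, 0 < s.re →
      H s = ∑ i, (s - lam i)⁻¹ • Matrix.vecMulVec (c i) (star (b i))) :
    (∀ i, (lam i).re < 0) ∧ (∀ i, b i ≠ 0) ∧ ∀ i, c i ≠ 0 := by
  obtain ⟨A, B, C, hA, hmin, hABC⟩ := hmem
  have htf : ∀ s : ℂ, 0 < s.re → transferFunction A B C s =
      ∑ i, (s - lam i)⁻¹ • Matrix.vecMulVec (c i) (star (b i)) := fun s hs => by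
    rw [← hABC s hs, hH s hs]
  have hres := vecMulVec_ne_zero_of_isMinimalRealization hmin htf
  have hb : ∀ i, b i ≠ 0 := fun i h0 => hres i (by
    ext k l
    simp [Matrix.vecMulVec_apply, h0])
  have hc : ∀ i, c i ≠ 0 := fun i h0 => hres i (by rw [h0, Matrix.zero_vecMulVec])
  exact ⟨fun i => hA _ (mem_spectrum_of_transferFunction_eq hlam hb hc htf i), hb, hc⟩

/-- A velocity of a curve of functions of McMillan degree `r` through a function in pole-residue
form is a combination of perturbations of the residue vectors and of the state matrix. -/
theorem exists_form_of_hasDerivAt {Hhat G : HardyTwo p m} (hlam : Function.Injective lam)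
    (hre : ∀ i, (lam i).re < 0) (hb : ∀ i, b i ≠ 0) (hc : ∀ i, c i ≠ 0)
    (hH : ∀ s : ℂ, 0 < s.re →
      Hhat s = ∑ i, (s - lam i)⁻¹ • Matrix.vecMulVec (c i) (star (b i)))
    {g : ℝ → HardyTwo p m} (hg : ∀ᶠ t in 𝓝 0, g t ∈ stableRational r m p) (hg0 : g 0 = Hhat)
    (hG : HasDerivAt g G 0) :
    ∃ (X : Matrix (Fin p) (Fin r) ℂ) (Y : Matrix (Fin r) (Fin m) ℂ)
      (Z : Matrix (Fin r) (Fin r) ℂ), ∀ s : ℂ, 0 < s.re →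
      G s = X * Matrix.diagonal (fun i => (s - lam i)⁻¹) * (Matrix.of fun i => star (b i)) +
        (Matrix.of c)ᵀ * Matrix.diagonal (fun i => (s - lam i)⁻¹) * Y +
        (Matrix.of c)ᵀ * Matrix.diagonal (fun i => (s - lam i)⁻¹) * Z *
          Matrix.diagonal (fun i => (s - lam i)⁻¹) * (Matrix.of fun i => star (b i)) := by
  obtain ⟨u, hu⟩ := exists_dotProduct_ne_zero hc
  obtain ⟨v, hv⟩ := exists_dotProduct_ne_zero (c := fun i => star (b i))
    fun i => star_ne_zero.2 (hb i)
  obtain ⟨σ, τ, hσ, hτ, hστ, hσS, hτS⟩ := exists_interpolation_points r (S := ∅) finite_empty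
  have hne : ∀ s : ℂ, 0 < s.re → ∀ i, s ≠ lam i := by
    rintro s hs i rfl
    exact lt_asymm hs (hre i)
  have hspec : ∀ s : ℂ, 0 < s.re → s ∉ spectrum ℂ (Matrix.diagonal lam) := fun s hs =>
    notMem_spectrum_diagonal_iff.2 (hne s hs)
  have htf : ∀ s : ℂ, 0 < s.re → Hhat s = transferFunction (Matrix.diagonal lam)
      (Matrix.of fun i => star (b i)) (Matrix.of c)ᵀ s := fun s hs => by
    rw [transferFunction_diagonal (hne s hs), hH s hs]
  have heval : ∀ s : ℂ, 0 < s.re → ∀ i j, HasDerivAt (fun t => g t s i j) (G s i j) 0 :=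
    fun s hs i j => HardyTwo.hasDerivAt_apply hG hs i j
  -- All Loewner data are linear in finitely many point values of `H`, so their derivatives along
  -- the curve are the same data of the velocity `G`.
  have hW : ∀ i j, HasDerivAt (fun t => rightData v τ (g t) i j) (rightData v τ G i j) 0 := by
    intro i j
    simp only [rightData, Matrix.of_apply, Matrix.mulVec, dotProduct]
    exact HasDerivAt.fun_sum fun k _ => (heval _ (hτS j).1 i k).mul_const (v k)
  have hV : ∀ i j, HasDerivAt (fun t => leftData u σ (g t) i j) (leftData u σ G i j) 0 := by
    intro i j
    simp only [leftData, Matrix.of_apply, Matrix.vecMul, dotProduct]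
    exact HasDerivAt.fun_sum fun k _ => (heval _ (hσS i).1 k j).const_mul (u k)
  have hquad : ∀ s : ℂ, 0 < s.re →
      HasDerivAt (fun t => u ⬝ᵥ (g t s *ᵥ v)) (u ⬝ᵥ (G s *ᵥ v)) 0 := fun s hs =>
    HasDerivAt.fun_sum fun i _ => (HasDerivAt.fun_sum fun k _ =>
      (heval s hs i k).mul_const (v k)).const_mul (u i)
  have hL : ∀ i j, HasDerivAt (fun t => loewner u v σ τ (g t) i j) (loewner u v σ τ G i j) 0 :=
    fun i j => ((hquad _ (hτS j).1).sub (hquad _ (hσS i).1)).div_const _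
  have hLs : ∀ i j, HasDerivAt (fun t => shiftedLoewner u v σ τ (g t) i j)
      (shiftedLoewner u v σ τ G i j) 0 :=
    fun i j => ((hL i j).const_mul (τ j)).sub (hquad _ (hσS i).1)
  have hdet0 : (loewner u v σ τ (g 0)).det ≠ 0 := by
    rw [hg0]
    exact det_loewner_ne_zero hlam hσ hτ (fun k => hne _ (hσS k).1) (fun j => hne _ (hτS j).1) hστ
      hu hv (fun k => hH _ (hσS k).1) (fun j => hH _ (hτS j).1)
  have hdet : ∀ᶠ t in 𝓝 0, (loewner u v σ τ (g t)).det ≠ 0 :=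
    (differentiableAt_matrix_det fun i j => (hL i j).differentiableAt).continuousAt.eventually_ne
      hdet0
  -- A realization of `g t` is used only at a fixed `t`; the resulting formula no longer mentions it
  -- and depends differentiably on `t`.
  have hform : ∀ s : ℂ, 0 < s.re → ∀ᶠ t in 𝓝 0, g t s = rightData v τ (g t) *
      (s • loewner u v σ τ (g t) - shiftedLoewner u v σ τ (g t))⁻¹ * leftData u σ (g t) := by
    intro s hs
    filter_upwards [hdet, hg] with t ht htmem
    obtain ⟨A, B, C, hA, -, hABC⟩ := htmem
    rw [← transferFunction_eq_loewner (A := A) (B := B) (C := C)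
      (fun k => hA.notMem_spectrum (hσS k).1) (fun j => hA.notMem_spectrum (hτS j).1) hστ
      (fun k => hABC _ (hσS k).1) (fun j => hABC _ (hτS j).1) ht, hABC s hs]
  set Λ : Matrix (Fin r) (Fin r) ℂ := Matrix.diagonal lam with hΛ
  set B : Matrix (Fin r) (Fin m) ℂ := Matrix.of fun i => star (b i) with hB
  set C : Matrix (Fin p) (Fin r) ℂ := (Matrix.of c)ᵀ with hC
  have hHσ : ∀ k, Hhat (σ k) = transferFunction Λ B C (σ k) := fun k => htf _ (hσS k).1
  have hHτ : ∀ j, Hhat (τ j) = transferFunction Λ B C (τ j) := fun j => htf _ (hτS j).1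
  set O := observabilityMatrix u σ Λ C with hO
  set R := reachabilityMatrix v τ Λ B with hR
  have hOdet : IsUnit O.det := isUnit_iff_ne_zero.2
    (det_observabilityMatrix_diagonal_ne_zero hσ hlam (fun k => hne _ (hσS k).1) hu)
  have hRdet : IsUnit R.det := isUnit_iff_ne_zero.2
    (det_reachabilityMatrix_diagonal_ne_zero hτ hlam (fun k => hne _ (hτS k).1) hv)
  have hWV : rightData v τ Hhat = C * R ∧ leftData u σ Hhat = O * B :=
    ⟨(mul_reachabilityMatrix hHτ).symm, (observabilityMatrix_mul hHσ).symm⟩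
  set L' := loewner u v σ τ G with hL'
  set Ls' := shiftedLoewner u v σ τ G with hLs'
  set W' := rightData v τ G with hW'
  set V' := leftData u σ G with hV'
  -- With `N = (s - Λ)⁻¹`, the product rule gives `W' R⁻¹ N B - C N O⁻¹ (s L' - Ls') R⁻¹ N B + C N
  -- O⁻¹ V'`. The explicit `s` is removed by `s N = 1 + N Λ`, which moves one part of the `L'` term
  -- into `X` and the other into `Z`.
  refine ⟨W' * R⁻¹ - C * (O⁻¹ * L' * R⁻¹), O⁻¹ * V',
    O⁻¹ * Ls' * R⁻¹ - Λ * (O⁻¹ * L' * R⁻¹), fun s hs => ?_⟩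
  have hpencil : s • loewner u v σ τ Hhat - shiftedLoewner u v σ τ Hhat =
      O * (s • (1 : Matrix (Fin r) (Fin r) ℂ) - Λ) * R :=
    (observabilityMatrix_mul_pencil_mul (fun k => hspec _ (hσS k).1)
      (fun j => hspec _ (hτS j).1) hστ hHσ hHτ s).symm
  have hsunit := isUnit_det_smul_one_sub (hspec s hs)
  have hD : ∀ i j, HasDerivAt
      (fun t => (s • loewner u v σ τ (g t) - shiftedLoewner u v σ τ (g t)) i j)
      ((s • L' - Ls') i j) 0 := fun i j => ((hL i j).const_mul s).sub (hLs i j)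
  have hDdet : (s • loewner u v σ τ (g 0) - shiftedLoewner u v σ τ (g 0)).det ≠ 0 := by
    rw [hg0, hpencil, Matrix.det_mul, Matrix.det_mul]
    exact ((hOdet.mul hsunit).mul hRdet).ne_zero
  have hderiv := hasDerivAt_matrix_mul (hasDerivAt_matrix_mul hW (hasDerivAt_matrix_inv hD hDdet))
    hV
  have hGs : G s = (W' * (s • loewner u v σ τ (g 0) - shiftedLoewner u v σ τ (g 0))⁻¹ +
      rightData v τ (g 0) *
        -((s • loewner u v σ τ (g 0) - shiftedLoewner u v σ τ (g 0))⁻¹ * (s • L' - Ls') *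
          (s • loewner u v σ τ (g 0) - shiftedLoewner u v σ τ (g 0))⁻¹)) * leftData u σ (g 0) +
      rightData v τ (g 0) *
        (s • loewner u v σ τ (g 0) - shiftedLoewner u v σ τ (g 0))⁻¹ * V' := by
    ext i j
    refine (heval s hs i j).unique ((hderiv i j).congr_of_eventuallyEq ?_)
    filter_upwards [hform s hs] with t ht
    rw [ht]
  rw [hGs, hg0, hpencil, hWV.1, hWV.2, Matrix.mul_inv_rev, Matrix.mul_inv_rev,
    ← inv_smul_one_sub_diagonal (hne s hs)]
  set N := (s • (1 : Matrix (Fin r) (Fin r) ℂ) - Λ)⁻¹ with hN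
  have hRR : R * R⁻¹ = 1 := Matrix.mul_nonsing_inv _ hRdet
  have hOO : O⁻¹ * O = 1 := Matrix.nonsing_inv_mul _ hOdet
  have hsN : N * (s • (1 : Matrix (Fin r) (Fin r) ℂ)) = 1 + N * Λ := by
    have := Matrix.nonsing_inv_mul _ hsunit
    rw [Matrix.mul_sub] at this
    exact eq_add_of_sub_eq this
  have h1 : W' * (R⁻¹ * (N * O⁻¹)) * (O * B) = W' * R⁻¹ * N * B := by
    calc _ = W' * R⁻¹ * N * (O⁻¹ * O) * B := by simp only [Matrix.mul_assoc]
      _ = _ := by rw [hOO, Matrix.mul_one]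
  have h2 : C * R * (R⁻¹ * (N * O⁻¹)) * V' = C * N * (O⁻¹ * V') := by
    calc _ = C * (R * R⁻¹) * N * (O⁻¹ * V') := by simp only [Matrix.mul_assoc]
      _ = _ := by rw [hRR, Matrix.mul_one]
  have h3 : C * R * (R⁻¹ * (N * O⁻¹) * (s • L' - Ls') * (R⁻¹ * (N * O⁻¹))) * (O * B) =
      C * (O⁻¹ * L' * R⁻¹) * N * B + C * (N * Λ) * (O⁻¹ * L' * R⁻¹) * N * B -
        C * N * (O⁻¹ * Ls' * R⁻¹) * N * B := by
    calc _ = C * (R * R⁻¹) * N * O⁻¹ * (s • L' - Ls') * R⁻¹ * N * (O⁻¹ * O) * B := by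
          simp only [Matrix.mul_assoc]
      _ = C * N * O⁻¹ * (s • L' - Ls') * R⁻¹ * N * B := by
          rw [hRR, hOO, Matrix.mul_one, Matrix.mul_one]
      _ = C * (N * (s • (1 : Matrix (Fin r) (Fin r) ℂ))) * (O⁻¹ * L' * R⁻¹) * N * B -
          C * N * (O⁻¹ * Ls' * R⁻¹) * N * B := by
          simp only [Matrix.mul_sub, Matrix.sub_mul, Matrix.mul_smul, Matrix.smul_mul,
            Matrix.mul_one, Matrix.mul_assoc]
      _ = _ := by
          rw [hsN]
          simp only [Matrix.mul_add, Matrix.add_mul, Matrix.mul_one]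
  rw [Matrix.add_mul, h1, h2, Matrix.mul_neg, Matrix.neg_mul, h3]
  simp only [Matrix.sub_mul, Matrix.mul_sub, Matrix.mul_assoc]
  abel

theorem trace_conjTranspose_vecMulVec_mul (x : Fin p → ℂ) (y : Fin m → ℂ)
    (M : Matrix (Fin p) (Fin m) ℂ) :
    ((Matrix.vecMulVec x (star y))ᴴ * M).trace = star x ⬝ᵥ (M *ᵥ y) := by
  rw [Matrix.conjTranspose_vecMulVec, star_star, Matrix.vecMulVec_mul, Matrix.trace_vecMulVec,
    dotProduct_comm, Matrix.dotProduct_mulVec]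

/-- In the form of a velocity found above, the `X` and `Y` terms are handled by the right and the
left condition, the diagonal of `Z` by the derivative condition. Off the diagonal, partial fractions
reduce to simple poles. -/
theorem isOrthogonalTo_tangentSpaceAt_of_interpolation {Hhat F : HardyTwo p m}
    (hlam : Function.Injective lam) (hre : ∀ i, (lam i).re < 0) (hb : ∀ i, b i ≠ 0)
    (hc : ∀ i, c i ≠ 0)
    (hH : ∀ s : ℂ, 0 < s.re →
      Hhat s = ∑ i, (s - lam i)⁻¹ • Matrix.vecMulVec (c i) (star (b i)))
    (hright : ∀ i, F (-conj (lam i)) *ᵥ b i = 0)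
    (hleft : ∀ i, star (c i) ᵥ* F (-conj (lam i)) = 0)
    (hbi : ∀ i, star (c i) ⬝ᵥ (matrixDeriv F (-conj (lam i)) *ᵥ b i) = 0) :
    F.IsOrthogonalTo (tangentSpaceAt (stableRational r m p) Hhat) := by
  rintro G ⟨ε, g, hε, -, hg, hg0, hG⟩
  obtain ⟨X, Y, Z, hXYZ⟩ := exists_form_of_hasDerivAt hlam hre hb hc hH
    (eventually_of_mem (Ioo_mem_nhds (neg_lt_zero.2 hε) hε) hg) hg0 hG
  have hR : ∀ i x, HardyTwo.pole (lam i) 0 (Matrix.vecMulVec x (star (b i))) ∈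
      HardyTwo.orthogonalSubmodule F := by
    intro i x
    rw [HardyTwo.mem_orthogonalSubmodule, HardyTwo.innerH2_pole_zero (hre i),
      trace_conjTranspose_vecMulVec_mul, hright, dotProduct_zero]
  have hL : ∀ i y, HardyTwo.pole (lam i) 0 (Matrix.vecMulVec (c i) y) ∈
      HardyTwo.orthogonalSubmodule F := by
    intro i y
    rw [HardyTwo.mem_orthogonalSubmodule, HardyTwo.innerH2_pole_zero (hre i), ← star_star y,
      trace_conjTranspose_vecMulVec_mul, Matrix.dotProduct_mulVec, hleft, zero_dotProduct]
  have hRL : ∀ i, HardyTwo.pole (lam i) 1 (Matrix.vecMulVec (c i) (star (b i))) ∈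
      HardyTwo.orthogonalSubmodule F := by
    intro i
    rw [HardyTwo.mem_orthogonalSubmodule, HardyTwo.innerH2_pole_one (hre i),
      trace_conjTranspose_vecMulVec_mul, hbi, neg_zero]
  -- `Q i j` represents `cᵢ bⱼ* / ((s - λᵢ)(s - λⱼ))`. For `i ≠ j` its pole at `λᵢ` has left factor
  -- `cᵢ` and its pole at `λⱼ` has right factor `bⱼ*`, so each is annihilated by the condition at
  -- its own pole.
  set Q : Fin r → Fin r → HardyTwo p m := fun i j =>
    if i = j then HardyTwo.pole (lam i) 1 (Matrix.vecMulVec (c i) (star (b i)))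
    else (lam i - lam j)⁻¹ • (HardyTwo.pole (lam i) 0 (Matrix.vecMulVec (c i) (star (b j))) -
      HardyTwo.pole (lam j) 0 (Matrix.vecMulVec (c i) (star (b j)))) with hQ
  have hQmem : ∀ i j, Q i j ∈ HardyTwo.orthogonalSubmodule F := by
    intro i j
    by_cases hij : i = j
    · simp only [hQ, if_pos hij]
      exact hRL i
    · simp only [hQ, if_neg hij]
      exact Submodule.smul_mem _ _ (Submodule.sub_mem _ (hL i _) (hR j _))
  have hQapply : ∀ i j (s : ℂ), 0 < s.re → Q i j s =
      ((s - lam i)⁻¹ * (s - lam j)⁻¹) • Matrix.vecMulVec (c i) (star (b j)) := by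
    intro i j s hs
    have hi : s - lam i ≠ 0 := sub_ne_zero.2 fun h => lt_asymm hs (h ▸ hre i)
    have hj : s - lam j ≠ 0 := sub_ne_zero.2 fun h => lt_asymm hs (h ▸ hre j)
    by_cases hij : i = j
    · subst hij
      simp only [hQ, if_true]
      rw [HardyTwo.pole_apply (hre i) _ _ hs, ← mul_inv, ← sq]
    · have hd : lam i - lam j ≠ 0 := sub_ne_zero.2 (hlam.ne hij)
      simp only [hQ, if_neg hij]
      rw [HardyTwo.smul_apply, HardyTwo.sub_apply, HardyTwo.pole_apply (hre i) _ _ hs,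
        HardyTwo.pole_apply (hre j) _ _ hs, ← sub_smul, smul_smul]
      congr 1
      simp only [zero_add, pow_one]
      field_simp
      ring
  have hGeq : G = (∑ i, HardyTwo.pole (lam i) 0
        (Matrix.vecMulVec (fun k => X k i) (star (b i))) +
      ∑ i, HardyTwo.pole (lam i) 0 (Matrix.vecMulVec (c i) (Y i))) +
      ∑ i, ∑ j, Z i j • Q i j := by
    refine HardyTwo.ext_of_re_pos fun s hs => ?_
    rw [hXYZ s hs, HardyTwo.add_apply, HardyTwo.add_apply, HardyTwo.sum_apply, HardyTwo.sum_apply,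
      HardyTwo.sum_apply]
    simp only [HardyTwo.sum_apply, HardyTwo.smul_apply, hQapply _ _ s hs,
      HardyTwo.pole_apply (hre _) _ _ hs, zero_add, pow_one]
    congr 1
    · rw [mul_diagonal_mul_eq_sum, mul_diagonal_mul_eq_sum]
      rfl
    · rw [mul_diagonal_mul_eq_sum, Finset.sum_comm]
      refine Finset.sum_congr rfl fun j _ => ?_
      ext k l
      have hcol : ((Matrix.of c)ᵀ * Matrix.diagonal (fun i => (s - lam i)⁻¹) * Z) k j =
          ∑ i, (s - lam i)⁻¹ * Z i j * c i k := by
        rw [Matrix.mul_apply]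
        refine Finset.sum_congr rfl fun i _ => ?_
        rw [Matrix.mul_diagonal, Matrix.transpose_apply, Matrix.of_apply]
        ring
      rw [Matrix.smul_apply, Matrix.vecMulVec_apply, hcol, Matrix.sum_apply, Finset.sum_mul,
        Finset.smul_sum]
      refine Finset.sum_congr rfl fun i _ => ?_
      simp only [Matrix.smul_apply, Matrix.vecMulVec_apply, smul_eq_mul, Matrix.of_apply]
      ring
  rw [← HardyTwo.mem_orthogonalSubmodule, hGeq]
  exact Submodule.add_mem _ (Submodule.add_mem _ (Submodule.sum_mem _ fun i _ => hR i _)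
    (Submodule.sum_mem _ fun i _ => hL i _))
    (Submodule.sum_mem _ fun i _ => Submodule.sum_mem _ fun j _ =>
      Submodule.smul_mem _ _ (hQmem i j))

/-- Continuous perturbations of the poles and the residue vectors yield curves through `Hhat`,
whose velocities are tangent vectors. -/
theorem mem_tangentSpaceAt_of_poleResidue {Hhat G : HardyTwo p m} (hlam : Function.Injective lam)
    (hre : ∀ i, (lam i).re < 0) (hb : ∀ i, b i ≠ 0) (hc : ∀ i, c i ≠ 0)
    {lamt : ℝ → Fin r → ℂ} {bt : ℝ → Fin r → Fin m → ℂ} {ct : ℝ → Fin r → Fin p → ℂ}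
    (hlamt : ContinuousAt lamt 0) (hbt : ContinuousAt bt 0) (hct : ContinuousAt ct 0)
    (hlam0 : lamt 0 = lam) (hb0 : bt 0 = b) (hc0 : ct 0 = c) {g : ℝ → HardyTwo p m} {U : Set ℝ}
    (hU : U ∈ 𝓝 0) (hgU : ContDiffOn ℝ ∞ g U)
    (hg : ∀ t ∈ U, ∀ s : ℂ, 0 < s.re →
      g t s = ∑ i, (s - lamt t i)⁻¹ • Matrix.vecMulVec (ct t i) (star (bt t i)))
    (hg0 : g 0 = Hhat) (hG : HasDerivAt g G 0) :
    G ∈ tangentSpaceAt (stableRational r m p) Hhat := by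
  have hlamt' := continuousAt_pi.1 hlamt
  have hbt' := continuousAt_pi.1 hbt
  have hct' := continuousAt_pi.1 hct
  -- Distinct poles, stability and nonzero residue vectors are open conditions, and they suffice for
  -- membership in `Σ`.
  have hmem : ∀ᶠ t in 𝓝 (0 : ℝ), t ∈ U ∧ g t ∈ stableRational r m p := by
    have h1 : ∀ᶠ t in 𝓝 (0 : ℝ), ∀ i j, i ≠ j → lamt t i ≠ lamt t j := by
      refine eventually_all.2 fun i => eventually_all.2 fun j => eventually_all.2 fun hij => ?_
      refine ((hlamt' i).sub (hlamt' j)).eventually_ne (y := 0) ?_ |>.mono fun t ht =>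
        sub_ne_zero.1 ht
      simpa [hlam0, sub_eq_zero] using hlam.ne hij
    have h2 : ∀ᶠ t in 𝓝 (0 : ℝ), ∀ i, (lamt t i).re < 0 := by
      refine eventually_all.2 fun i => ?_
      refine (Complex.continuous_re.continuousAt.comp (hlamt' i)).eventually_lt_const ?_
      simpa [hlam0] using hre i
    have h3 : ∀ᶠ t in 𝓝 (0 : ℝ), ∀ i, bt t i ≠ 0 :=
      eventually_all.2 fun i => (hbt' i).eventually_ne (by simpa [hb0] using hb i)
    have h4 : ∀ᶠ t in 𝓝 (0 : ℝ), ∀ i, ct t i ≠ 0 :=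
      eventually_all.2 fun i => (hct' i).eventually_ne (by simpa [hc0] using hc i)
    filter_upwards [hU, h1, h2, h3, h4] with t htU ht1 ht2 ht3 ht4
    exact ⟨htU, mem_stableRational_of_poleResidue
      (fun i j hij => by_contra fun hne => ht1 i j hne hij) ht2 ht3 ht4 (hg t htU)⟩
  obtain ⟨ε, hε, hball⟩ := Metric.eventually_nhds_iff_ball.1 hmem
  rw [Real.ball_eq_Ioo, zero_sub, zero_add] at hball
  exact ⟨ε, g, hε, hgU.mono fun t ht => (hball t ht).1, fun t ht => (hball t ht).2, hg0, hG⟩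

/-- Velocity of replacing `cᵢ` by `cᵢ + t x`. -/
theorem pole_mem_tangentSpaceAt_left {Hhat : HardyTwo p m} (hlam : Function.Injective lam)
    (hre : ∀ i, (lam i).re < 0) (hb : ∀ i, b i ≠ 0) (hc : ∀ i, c i ≠ 0)
    (hH : ∀ s : ℂ, 0 < s.re →
      Hhat s = ∑ i, (s - lam i)⁻¹ • Matrix.vecMulVec (c i) (star (b i))) (i : Fin r)
    (x : Fin p → ℂ) :
    HardyTwo.pole (lam i) 0 (Matrix.vecMulVec x (star (b i))) ∈
      tangentSpaceAt (stableRational r m p) Hhat := by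
  refine mem_tangentSpaceAt_of_poleResidue hlam hre hb hc (lamt := fun _ => lam) (bt := fun _ => b)
    (ct := fun t => c + Pi.single i ((t : ℂ) • x))
    (g := fun t => Hhat + t • HardyTwo.pole (lam i) 0 (Matrix.vecMulVec x (star (b i))))
    continuousAt_const continuousAt_const ?_ rfl rfl (by simp) univ_mem ?_ ?_ (by simp) ?_
  · have : Continuous fun t : ℝ => c + Pi.single i ((t : ℂ) • x) := by
      refine continuous_const.add ((continuous_single i).comp (by fun_prop))
    exact this.continuousAt
  · exact (contDiff_const.add (contDiff_id.smul contDiff_const)).contDiffOn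
  · intro t _ s hs
    rw [HardyTwo.add_apply, HardyTwo.real_smul_apply, HardyTwo.pole_apply (hre i) _ _ hs, hH s hs]
    simp only [Pi.add_apply, Matrix.add_vecMulVec, smul_add, Finset.sum_add_distrib]
    congr 1
    rw [Finset.sum_eq_single i]
    · rw [Pi.single_eq_same, Matrix.smul_vecMulVec, zero_add, pow_one, smul_comm]
    · intro j _ hj
      rw [Pi.single_eq_of_ne hj, Matrix.zero_vecMulVec, smul_zero]
    · simp
  · simpa using ((hasDerivAt_id (0 : ℝ)).smul_const
      (HardyTwo.pole (lam i) 0 (Matrix.vecMulVec x (star (b i))))).const_add Hhat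

/-- Velocity of replacing `bᵢ` by `bᵢ + t y`; since `t` is real, the curve stays affine after
conjugation. -/
theorem pole_mem_tangentSpaceAt_right {Hhat : HardyTwo p m} (hlam : Function.Injective lam)
    (hre : ∀ i, (lam i).re < 0) (hb : ∀ i, b i ≠ 0) (hc : ∀ i, c i ≠ 0)
    (hH : ∀ s : ℂ, 0 < s.re →
      Hhat s = ∑ i, (s - lam i)⁻¹ • Matrix.vecMulVec (c i) (star (b i))) (i : Fin r)
    (y : Fin m → ℂ) :
    HardyTwo.pole (lam i) 0 (Matrix.vecMulVec (c i) (star y)) ∈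
      tangentSpaceAt (stableRational r m p) Hhat := by
  refine mem_tangentSpaceAt_of_poleResidue hlam hre hb hc (lamt := fun _ => lam) (ct := fun _ => c)
    (bt := fun t => b + Pi.single i ((t : ℂ) • y))
    (g := fun t => Hhat + t • HardyTwo.pole (lam i) 0 (Matrix.vecMulVec (c i) (star y)))
    continuousAt_const ?_ continuousAt_const rfl (by simp) rfl univ_mem ?_ ?_ (by simp) ?_
  · have : Continuous fun t : ℝ => b + Pi.single i ((t : ℂ) • y) := by
      refine continuous_const.add ((continuous_single i).comp (by fun_prop))
    exact this.continuousAt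
  · exact (contDiff_const.add (contDiff_id.smul contDiff_const)).contDiffOn
  · intro t _ s hs
    rw [HardyTwo.add_apply, HardyTwo.real_smul_apply, HardyTwo.pole_apply (hre i) _ _ hs, hH s hs]
    simp only [Pi.add_apply, star_add, Matrix.vecMulVec_add, smul_add, Finset.sum_add_distrib]
    congr 1
    rw [Finset.sum_eq_single i]
    · rw [Pi.single_eq_same, star_smul, Complex.star_def, Complex.conj_ofReal,
        Matrix.vecMulVec_smul, zero_add, pow_one, smul_comm]
    · intro j _ hj
      ext k l
      simp [Matrix.vecMulVec_apply, Pi.single_eq_of_ne hj]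
    · simp
  · simpa using ((hasDerivAt_id (0 : ℝ)).smul_const
      (HardyTwo.pole (lam i) 0 (Matrix.vecMulVec (c i) (star y)))).const_add Hhat

/-- Velocity of moving `λᵢ` to `λᵢ + t`. One real direction suffices, because orthogonality to this
velocity is already a complex equation. -/
theorem pole_one_mem_tangentSpaceAt {Hhat : HardyTwo p m} (hlam : Function.Injective lam)
    (hre : ∀ i, (lam i).re < 0) (hb : ∀ i, b i ≠ 0) (hc : ∀ i, c i ≠ 0)
    (hH : ∀ s : ℂ, 0 < s.re →
      Hhat s = ∑ i, (s - lam i)⁻¹ • Matrix.vecMulVec (c i) (star (b i))) (i : Fin r) :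
    HardyTwo.pole (lam i) 1 (Matrix.vecMulVec (c i) (star (b i))) ∈
      tangentSpaceAt (stableRational r m p) Hhat := by
  set M := Matrix.vecMulVec (c i) (star (b i)) with hM
  have hopen : IsOpen {t : ℝ | (lam i + t).re < 0} :=
    isOpen_lt (Complex.continuous_re.comp (by fun_prop)) continuous_const
  have h0 : (lam i + (0 : ℝ)).re < 0 := by simpa using hre i
  refine mem_tangentSpaceAt_of_poleResidue hlam hre hb hc (bt := fun _ => b) (ct := fun _ => c)
    (lamt := fun t => Function.update lam i (lam i + t)) (U := {t : ℝ | (lam i + t).re < 0})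
    (g := fun t => Hhat - HardyTwo.pole (lam i) 0 M + HardyTwo.pole (lam i + t) 0 M)
    ?_ continuousAt_const continuousAt_const (by simp) rfl rfl (hopen.mem_nhds h0) ?_ ?_
    (by simp) ?_
  · exact (continuous_const.update i (by fun_prop)).continuousAt
  · exact contDiffOn_const.add (HardyTwo.contDiffOn_pole (lam i) 0 M)
  · intro t ht s hs
    rw [HardyTwo.add_apply, HardyTwo.sub_apply, HardyTwo.pole_apply (hre i) _ _ hs,
      HardyTwo.pole_apply ht _ _ hs, hH s hs, ← Finset.add_sum_erase _ _ (Finset.mem_univ i),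
      ← Finset.add_sum_erase Finset.univ
        (fun j => (s - Function.update lam i (lam i + t) j)⁻¹ • Matrix.vecMulVec (c j) (star (b j)))
        (Finset.mem_univ i)]
    have hrest : ∀ j ∈ Finset.univ.erase i,
        (s - Function.update lam i (lam i + t) j)⁻¹ • Matrix.vecMulVec (c j) (star (b j)) =
          (s - lam j)⁻¹ • Matrix.vecMulVec (c j) (star (b j)) := by
      intro j hj
      rw [Function.update_of_ne (Finset.ne_of_mem_erase hj)]
    rw [Finset.sum_congr rfl hrest, Function.update_self, zero_add, pow_one, pow_one, ← hM]
    abel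
  · simpa using (HardyTwo.hasDerivAt_pole (lam i) 0 M h0).const_add
      (Hhat - HardyTwo.pole (lam i) 0 M)

end TangentSpace

/-! ### Orthogonality and interpolation -/

theorem mainTheorem3 {r m p : ℕ} (Hhat : HardyTwo p m) (hH : Hhat ∈ stableRational r m p)
    (lam : Fin r → ℂ) (b : Fin r → Fin m → ℂ) (c : Fin r → Fin p → ℂ)
    (hlam : Function.Injective lam)
    (hpr : ∀ s : ℂ, 0 < s.re →
      Hhat s = ∑ i, (s - lam i)⁻¹ • Matrix.vecMulVec (c i) (star (b i)))
    (F : HardyTwo p m) :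
    F.IsOrthogonalTo (tangentSpaceAt (stableRational r m p) Hhat) ↔
      ∀ i, F (-conj (lam i)) *ᵥ b i = 0 ∧
        star (c i) ᵥ* F (-conj (lam i)) = 0 ∧
        star (c i) ⬝ᵥ (matrixDeriv F (-conj (lam i)) *ᵥ b i) = 0 := by
  obtain ⟨hre, hb, hc⟩ := poleResidue_of_mem_stableRational hH hlam hpr
  refine ⟨fun hF i => ⟨?_, ?_, ?_⟩, fun h => isOrthogonalTo_tangentSpaceAt_of_interpolation hlam
    hre hb hc hpr (fun i => (h i).1) (fun i => (h i).2.1) fun i => (h i).2.2⟩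
  · refine dotProduct_eq_zero _ fun x => ?_
    rw [dotProduct_comm, ← star_star x, ← trace_conjTranspose_vecMulVec_mul,
      ← HardyTwo.innerH2_pole_zero (hre i)]
    exact hF _ (pole_mem_tangentSpaceAt_left hlam hre hb hc hpr i _)
  · refine dotProduct_eq_zero _ fun y => ?_
    rw [← Matrix.dotProduct_mulVec, ← trace_conjTranspose_vecMulVec_mul,
      ← HardyTwo.innerH2_pole_zero (hre i)]
    exact hF _ (pole_mem_tangentSpaceAt_right hlam hre hb hc hpr i _)
  · rw [← trace_conjTranspose_vecMulVec_mul, ← neg_eq_zero,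
      ← HardyTwo.innerH2_pole_one (hre i)]
    exact hF _ (pole_one_mem_tangentSpaceAt hlam hre hb hc hpr i)
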